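/- Consider $N\ge 1$ classes of status packets sharing a single server with an infinite buffer, which serves packets first-come-first-served, without idling while a packet is present. Class-$n$ packets arrive (are generated) according to a Poisson process of rate $\lambda_n>0$; class-$n$ service times are positive and i.i.d. with mean $x_n$ and finite second moment $y_n$; the arrival processes of all classes and the service times of all packets are independent. The system is empty at time $0$. Assume $\rho:=\sum_{j=1}^N\lambda_jx_j<1$. The status age $\Delta_n(t)$ of class $n$ is the time elapsed at time $t$ since the generation of the latest class-$n$ packet received (i.e. whose service was completed) up to time $t$; before the first reception it is counted from time $0$. Let $A_{nk}$ be the $k$-th peak of $\Delta_n$, i.e. its left limit at the time of reception of the $k$-th class-$n$ packet. Let $W^{(i)}$ be the waiting time (time from arrival to start of service) of the $i$-th packet of the system in order of arrival. Then for every class $n$ the peak age-of-information $A_{p,n}:=\lim_{K\to\infty}\frac1K\sum_{k=1}^KA_{nk}$ exists almost surely, and almost surely $$A_{p,n}=\frac1{\lambda_n}+x_n+\frac{\sum_j\lambda_jy_j}{2\bigl(1-\sum_j\lambda_jx_j\bigr)} .$$ Moreover the mean waiting time $W:=\lim_{K\to\infty}\frac1K\sum_{i=1}^KW^{(i)}$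 exists almost surely and equals $\frac{\sum_j\lambda_jy_j}{2(1-\rho)}$. Consequently the conservation law $$\sum_{n=1}^N\lambda_nA_{p,n}=N+\rho+\Bigl(\sum_{n=1}^N\lambda_n\Bigr)W$$ holds, and for all classes $n,m$ $$A_{p,n}-\frac1{\lambda_n}-x_n=A_{p,m}-\frac1{\lambda_m}-x_m,\qquad \frac1{\lambda_n}-\frac1{\lambda_m}=(A_{p,n}-x_n)-(A_{p,m}-x_m);$$ in particular $\lambda_m>\lambda_n$ implies $A_{p,n}-x_n>A_{p,m}-x_m$. -/

import Mathlib

open MeasureTheory ProbabilityTheory Filter Topology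

noncomputable section

namespace MG1

/-! ### One sample path of the queue

`I n 0` is the time of the first class-`n` arrival, `I n (k+1)` is the time between the `k`-th and
the `(k+1)`-st class-`n` packet, and `X n k` is the service time of the `k`-th class-`n` packet; `k` starts at `0`.
The system is empty at time `0`. -/

/-- The generation (= arrival) time of the `k`-th packet of class `n`. -/
def arrivalTime {N : ℕ} (I : Fin N → ℕ → ℝ) (n : Fin N) (k : ℕ) : ℝ :=
  ∑ i ∈ Finset.range (k + 1), I n i

/-- A class at which `f` is minimal. -/
def earliest {N : ℕ} [NeZero N] (f : Fin N → ℝ) : Fin N :=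
  Classical.choose (Finite.exists_min f)

/-- All packets, of whatever class, are numbered `0, 1, 2, …` in the order of their arrival.
`arrivedBefore I i n` is the number of class-`n` packets among the first `i` packets; the `i`-th
packet is of the class whose next packet arrives first. -/
def arrivedBefore {N : ℕ} [NeZero N] (I : Fin N → ℕ → ℝ) : ℕ → Fin N → ℕ
  | 0 => fun _ => 0
  | i + 1 =>
    Function.update (arrivedBefore I i)
      (earliest fun m => arrivalTime I m (arrivedBefore I i m))
      (arrivedBefore I i (earliest fun m => arrivalTime I m (arrivedBefore I i m)) + 1)

/-- The class of the `i`-th packet in the order of arrival. -/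
def packetClass {N : ℕ} [NeZero N] (I : Fin N → ℕ → ℝ) (i : ℕ) : Fin N :=
  earliest fun m => arrivalTime I m (arrivedBefore I i m)

/-- The generation time of the `i`-th packet in the order of arrival. -/
def generationTime {N : ℕ} [NeZero N] (I : Fin N → ℕ → ℝ) (i : ℕ) : ℝ :=
  arrivalTime I (packetClass I i) (arrivedBefore I i (packetClass I i))

/-- The service time of the `i`-th packet in the order of arrival. -/
def serviceTime {N : ℕ} [NeZero N] (I X : Fin N → ℕ → ℝ) (i : ℕ) : ℝ :=
  X (packetClass I i) (arrivedBefore I i (packetClass I i))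

/-- The time at which the service of the `i`-th packet begins: there is a single server, and it
serves the packets in the order of arrival, never idling while a packet is present. -/
def serviceStart {N : ℕ} [NeZero N] (I X : Fin N → ℕ → ℝ) : ℕ → ℝ
  | 0 => generationTime I 0
  | i + 1 => max (generationTime I (i + 1)) (serviceStart I X i + serviceTime I X i)

/-- The time at which the `i`-th packet leaves the queue, i.e. is received. -/
def receptionTime {N : ℕ} [NeZero N] (I X : Fin N → ℕ → ℝ) (i : ℕ) : ℝ :=
  serviceStart I X i + serviceTime I X i

/-- The waiting time of the `i`-th packet (its service time not included). -/
def waitingTime {N : ℕ} [NeZero N] (I X : Fin N → ℕ → ℝ) (i : ℕ) : ℝ :=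
  serviceStart I X i - generationTime I i

/-- The status age `Δ_n(t)`, for `t ≥ 0`: the time elapsed at time `t` since the generation of the
latest class-`n` packet received up to time `t`. As long as no class-`n` packet has been received,
the age is counted from time `0`. -/
def age {N : ℕ} [NeZero N] (I X : Fin N → ℕ → ℝ) (n : Fin N) (t : ℝ) : ℝ :=
  t - sSup ({0} ∪
    {g | ∃ i : ℕ, packetClass I i = n ∧ receptionTime I X i ≤ t ∧ g = generationTime I i})

/-- The time at which the `k`-th class-`n` packet is received; this is the `k`-th time at which
the status age of class `n` drops. -/
def dropTime {N : ℕ} [NeZero N] (I X : Fin N → ℕ → ℝ) (n : Fin N) (k : ℕ) : ℝ :=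
  receptionTime I X (Nat.nth (fun i => packetClass I i = n) k)

/-- The `k`-th peak `A_{nk}` of the status age of class `n`: the value reached by the age just
before its `k`-th drop. -/
def peakAge {N : ℕ} [NeZero N] (I X : Fin N → ℕ → ℝ) (n : Fin N) (k : ℕ) : ℝ :=
  Function.leftLim (age I X n) (dropTime I X n k)

/-! ### The stochastic model -/

/-- The primitives of the multi-class `M/G/1` queue: the classes have independent Poisson arrival
streams (i.i.d. exponential inter-arrival times) of rates `lam n`, and the service times of class
`n` are positive, i.i.d. with mean `x n` and second moment `y n`, independent of everything else. -/
structure IsMultiClassMG1 {N : ℕ} {Ω : Type*} [MeasurableSpace Ω] (μ : Measure Ω)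
    (lam x y : Fin N → ℝ) (I X : Fin N → ℕ → Ω → ℝ) : Prop where
  rate_pos : ∀ n, 0 < lam n
  measurable_interarrival : ∀ n k, Measurable (I n k)
  measurable_service : ∀ n k, Measurable (X n k)
  indep : iIndepFun (fun p : (Fin N × ℕ) ⊕ (Fin N × ℕ) =>
    Sum.elim (fun q => I q.1 q.2) (fun q => X q.1 q.2) p) μ
  interarrival_law : ∀ n k, HasLaw (I n k) (expMeasure (lam n)) μ
  service_identDistrib : ∀ n k, IdentDistrib (X n k) (X n 0) μ μ
  service_pos : ∀ n k, ∀ᵐ ω ∂μ, 0 < X n k ω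
  service_memLp : ∀ n, MemLp (X n 0) 2 μ
  service_mean : ∀ n, ∫ ω, X n 0 ω ∂μ = x n
  service_secondMoment : ∀ n, ∫ ω, (X n 0 ω) ^ 2 ∂μ = y n

/-- `a` is the peak age-of-information of class `n`: almost surely, the average of the first `K`
peaks of the status age converges to `a` as `K → ∞`. -/
def IsPeakAoI {N : ℕ} [NeZero N] {Ω : Type*} [MeasurableSpace Ω] (μ : Measure Ω)
    (I X : Fin N → ℕ → Ω → ℝ) (n : Fin N) (a : ℝ) : Prop :=
  ∀ᵐ ω ∂μ, Tendsto
    (fun K : ℕ => (1 / (K : ℝ)) * ∑ k ∈ Finset.range K,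
      peakAge (fun m j => I m j ω) (fun m j => X m j ω) n k)
    atTop (𝓝 a)

/-- `w` is the mean waiting time: almost surely, the average waiting time of the first `K` packets
converges to `w` as `K → ∞`. -/
def IsMeanWaitingTime {N : ℕ} [NeZero N] {Ω : Type*} [MeasurableSpace Ω] (μ : Measure Ω)
    (I X : Fin N → ℕ → Ω → ℝ) (w : ℝ) : Prop :=
  ∀ᵐ ω ∂μ, Tendsto
    (fun K : ℕ => (1 / (K : ℝ)) * ∑ i ∈ Finset.range K,
      waitingTime (fun m j => I m j ω) (fun m j => X m j ω) i)
    atTop (𝓝 w)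

end MG1

end

/-!
By the memorylessness of the exponential law, the first packet of the superposed streams is
independent of what remains of them, and the remaining streams have the same law as at the start.
Hence, in the order of arrival, the interarrival times are i.i.d. exponential of rate `λ = ∑ λ_n`
and the marks (class, service time) are i.i.d. and independent of them.

The waiting times then satisfy `W_{i+1} = (W_i + S_i - T_{i+1})⁺` (Lindley). For an exponential
`T` of rate `λ`, `E[(u - T)⁺] = λ/2 * E[u² - ((u - T)⁺)²]`. Therefore
`W_{i+1} - λ/2 * ((W_i + S_i)² - W_{i+1}²)` and `W_{i+1} (S_{i+1} - E S)` are martingale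
differences, and telescoping the squares expresses `(1 - λ E S) ∑ W_i` as `λ/2 ∑ S_i²`, plus
martingale terms, plus boundary terms at the last index. This is the Pollaczek–Khinchine formula,
once the extra terms are shown to be negligible.

Since `S` has only two moments, the sums of the `W_i` are not known to be `O(n)` beforehand, and
the martingales are normalized by the random sums `∑_{i ≤ n} (1 + W_i + S_i)` instead of `n`; the
energy identity itself then shows that these are `O(n)`. The boundary terms vanish at the indices
where the queue is idle, and the last such index before `n` is asymptotic to `n`.

As `W_i` is independent of the class of packet `i`, the packets of one class have the same mean
waiting time. The `k`-th peak of the age of class `n` is the sum of the time between the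
generations of its packets `k - 1` and `k`, of the waiting time of packet `k` and of its service
time.
-/

namespace MG1

open Asymptotics

/-! ### Averages and sums of real sequences -/

/-- **Kronecker's lemma**. -/
lemma isLittleO_sum_mul_of_tendsto_sum {a b : ℕ → ℝ} {s : ℝ} (hb : Monotone b)
    (hbtop : Tendsto b atTop atTop)
    (ha : Tendsto (fun n => ∑ i ∈ Finset.range n, a i) atTop (𝓝 s)) :
    (fun n => ∑ i ∈ Finset.range n, b i * a i) =o[atTop] b := by
  set σ : ℕ → ℝ := fun n => ∑ i ∈ Finset.range n, a i with hσ
  have abel : ∀ n, ∑ i ∈ Finset.range n, b i * a i =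
      b n * (σ n - s) - ∑ i ∈ Finset.range n, (b (i + 1) - b i) * (σ (i + 1) - s) + b 0 * s := by
    intro n
    induction n with
    | zero => simp [hσ]
    | succ n ih =>
      have : σ (n + 1) = σ n + a n := Finset.sum_range_succ _ _
      rw [Finset.sum_range_succ, ih, Finset.sum_range_succ, this]
      ring
  have hσs : (fun n => σ n - s) =o[atTop] (fun _ => (1 : ℝ)) :=
    (isLittleO_one_iff ℝ).2 (by simpa using ha.sub_const s)
  have hconst (c : ℝ) : (fun _ => c) =o[atTop] b :=
    isLittleO_const_left.2 (.inr (tendsto_norm_atTop_atTop.comp hbtop))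
  have hmain : (fun n => b n * (σ n - s)) =o[atTop] b := by
    simpa using (isBigO_refl b atTop).mul_isLittleO hσs
  have hincr : (fun n => ∑ i ∈ Finset.range n, (b (i + 1) - b i) * (σ (i + 1) - s)) =o[atTop]
      (fun n => ∑ i ∈ Finset.range n, (b (i + 1) - b i)) := by
    refine IsLittleO.sum_range ?_ (fun n => sub_nonneg.2 (hb n.le_succ)) ?_
    · simpa using (isBigO_refl (fun n => b (n + 1) - b n) atTop).mul_isLittleO
        (hσs.comp_tendsto (tendsto_add_atTop_nat 1))
    · simp_rw [Finset.sum_range_sub]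
      exact tendsto_atTop_add_const_right _ _ hbtop
  simp_rw [abel]
  refine (hmain.sub (hincr.trans_isBigO ?_)).add (hconst _)
  simp_rw [Finset.sum_range_sub]
  exact (isBigO_refl b atTop).sub (hconst _).isBigO

lemma pow_four_sub_pow_four_le {a b : ℝ} (hb : 0 ≤ b) (hba : b ≤ a) :
    a ^ 4 - b ^ 4 ≤ 4 * a ^ 3 * (a - b) := by
  have hsum : a ^ 3 + a ^ 2 * b + a * b ^ 2 + b ^ 3 ≤ 4 * a ^ 3 := by
    have ha : 0 ≤ a := hb.trans hba
    have h1 : a ^ 2 * b ≤ a ^ 2 * a := by gcongr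
    have h2 : a * b ^ 2 ≤ a * a ^ 2 := by gcongr
    have h3 : b ^ 3 ≤ a ^ 3 := by gcongr
    linarith
  calc a ^ 4 - b ^ 4 = (a ^ 3 + a ^ 2 * b + a * b ^ 2 + b ^ 3) * (a - b) := by ring
    _ ≤ 4 * a ^ 3 * (a - b) := mul_le_mul_of_nonneg_right hsum (sub_nonneg.2 hba)

lemma sq_div_pow_four_le {a b c : ℝ} (ha : 0 < a) (hb : 0 < b) (hba : b ≤ a)
    (hc : a ^ 4 - b ^ 4 ≤ c * a ^ 3) :
    ((a ^ 4 - b ^ 4) / a ^ 4) ^ 2 ≤ 4 * c * (1 / b - 1 / a) := by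
  have hdiff : 0 ≤ a ^ 4 - b ^ 4 := sub_nonneg.2 (by gcongr)
  have hc0 : 0 ≤ c := nonneg_of_mul_nonneg_left (hdiff.trans hc) (by positivity)
  have : 0 ≤ a - b := sub_nonneg.2 hba
  have hsq : (a ^ 4 - b ^ 4) ^ 2 ≤ c * a ^ 3 * (4 * a ^ 3 * (a - b)) := by
    rw [sq]
    exact mul_le_mul hc (pow_four_sub_pow_four_le hb.le hba) hdiff (by positivity)
  calc ((a ^ 4 - b ^ 4) / a ^ 4) ^ 2 = (a ^ 4 - b ^ 4) ^ 2 / a ^ 8 := by ring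
    _ ≤ c * a ^ 3 * (4 * a ^ 3 * (a - b)) / a ^ 8 := by gcongr
    _ = 4 * c * ((a - b) / (a * a)) := by field_simp
    _ ≤ 4 * c * ((a - b) / (b * a)) := by gcongr
    _ = 4 * c * (1 / b - 1 / a) := by field_simp

/-- The divergent quantity by which martingales with increments of order `1 + u i` are
normalized. -/
def normalizer (u : ℕ → ℝ) (n : ℕ) : ℝ :=
  ∑ j ∈ Finset.range (n + 1), (1 + u j)

lemma normalizer_succ (u : ℕ → ℝ) (n : ℕ) :
    normalizer u (n + 1) = normalizer u n + (1 + u (n + 1)) :=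
  Finset.sum_range_succ _ _

section Normalizer

variable {u : ℕ → ℝ} (hu : ∀ i, 0 ≤ u i)
include hu

lemma natCast_add_one_le_normalizer (n : ℕ) : (n + 1 : ℝ) ≤ normalizer u n := by
  have : ∑ _j ∈ Finset.range (n + 1), (1 : ℝ) ≤ normalizer u n :=
    Finset.sum_le_sum fun j _ => le_add_of_nonneg_right (hu j)
  simpa using this

lemma one_le_normalizer (n : ℕ) : 1 ≤ normalizer u n :=
  (le_add_of_nonneg_left n.cast_nonneg).trans (natCast_add_one_le_normalizer hu n)

lemma normalizer_pos (n : ℕ) : 0 < normalizer u n :=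
  zero_lt_one.trans_le (one_le_normalizer hu n)

lemma monotone_normalizer : Monotone (normalizer u) :=
  monotone_nat_of_le_succ fun n => by
    rw [normalizer_succ]
    linarith [hu (n + 1)]

lemma tendsto_normalizer_atTop : Tendsto (normalizer u) atTop atTop :=
  tendsto_atTop_mono (natCast_add_one_le_normalizer hu)
    (tendsto_atTop_add_const_right _ _ tendsto_natCast_atTop_atTop)

/-- With `q i` the fourth root of `normalizer u i`, the `i`-th term is at most
`4 * c * (1 / q (i - 1) - 1 / q i)`, and these bounds telescope. -/
lemma exists_sum_sq_div_normalizer_le {c : ℝ}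
    (hc : ∀ i, 1 + u i ≤ c * √√(normalizer u i) ^ 3) :
    ∃ C, ∀ n, ∑ i ∈ Finset.range n, ((1 + u i) / normalizer u i) ^ 2 ≤ C := by
  set q : ℕ → ℝ := fun i => √√(normalizer u i)
  have hqpos : ∀ i, 0 < q i := fun i => by
    have := normalizer_pos hu i
    positivity
  have hq4 : ∀ i, q i ^ 4 = normalizer u i := fun i => by
    rw [show 4 = 2 * 2 from rfl, pow_mul, Real.sq_sqrt (Real.sqrt_nonneg _),
      Real.sq_sqrt (normalizer_pos hu i).le]
  have hqmono : Monotone q := fun i j hij =>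
    Real.sqrt_le_sqrt (Real.sqrt_le_sqrt (monotone_normalizer hu hij))
  have hincr : ∀ i, 1 + u (i + 1) = q (i + 1) ^ 4 - q i ^ 4 := fun i => by
    rw [hq4, hq4, normalizer_succ]
    ring
  have hc0 : 0 ≤ c := by
    by_contra! h
    nlinarith [hc 0, hu 0, pow_pos (hqpos 0) 3]
  have hstep : ∀ i, ((1 + u (i + 1)) / normalizer u (i + 1)) ^ 2 ≤
      4 * c * (1 / q i - 1 / q (i + 1)) := fun i => by
    rw [← hq4, hincr]
    exact sq_div_pow_four_le (hqpos _) (hqpos _) (hqmono i.le_succ) (hincr i ▸ hc (i + 1))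
  have hsum : ∀ n, ∑ i ∈ Finset.range (n + 1), ((1 + u i) / normalizer u i) ^ 2 ≤
      ((1 + u 0) / normalizer u 0) ^ 2 + 4 * c * (1 / q 0 - 1 / q n) := fun n => by
    induction n with
    | zero => simp
    | succ n ih =>
      rw [Finset.sum_range_succ]
      linarith [hstep n]
  refine ⟨((1 + u 0) / normalizer u 0) ^ 2 + 4 * c * (1 / q 0), fun n => ?_⟩
  calc ∑ i ∈ Finset.range n, ((1 + u i) / normalizer u i) ^ 2
      ≤ ∑ i ∈ Finset.range (n + 1), ((1 + u i) / normalizer u i) ^ 2 :=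
        Finset.sum_le_sum_of_subset_of_nonneg (Finset.range_mono n.le_succ)
          fun _ _ _ => sq_nonneg _
    _ ≤ _ := hsum n
    _ ≤ _ := by
      have := hqpos n
      gcongr
      exact sub_le_self _ (by positivity)

end Normalizer

/-- `f` has long-run (Cesàro) average `a`. -/
def HasAverage (f : ℕ → ℝ) (a : ℝ) : Prop :=
  Tendsto (fun n : ℕ => (∑ i ∈ Finset.range n, f i) / n) atTop (𝓝 a)

lemma HasAverage.exists_sum_le_mul {f : ℕ → ℝ} {a : ℝ} (h : HasAverage f a) :
    ∃ C, 0 ≤ C ∧ ∀ n : ℕ, ∑ i ∈ Finset.range n, f i ≤ C * n := by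
  obtain ⟨C, hC⟩ := Tendsto.bddAbove_range h
  refine ⟨max C 0, le_max_right _ _, fun n => ?_⟩
  rcases n.eq_zero_or_pos with rfl | hn
  · simp
  · have hn' : (0 : ℝ) < n := by exact_mod_cast hn
    exact (div_le_iff₀ hn').1 ((hC ⟨n, rfl⟩).trans (le_max_left _ _))

lemma hasAverage_of_tendsto_sum_range_succ {f : ℕ → ℝ} {a : ℝ}
    (h : Tendsto (fun n : ℕ => (∑ i ∈ Finset.range (n + 1), f i) / n) atTop (𝓝 a)) :
    HasAverage f a := by
  rw [HasAverage, ← tendsto_add_atTop_iff_nat 1, ← mul_one a]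
  refine (h.mul (tendsto_natCast_div_add_atTop (𝕜 := ℝ) 1)).congr' ?_
  filter_upwards [eventually_ge_atTop 1] with n hn
  push_cast
  field_simp

/-! ### Sample paths of Lindley's recursion -/

/-- The waiting times of successive customers of a single server queue with service times `S i`,
where `T (i + 1)` is the time between the arrivals of the `i`-th and the `(i + 1)`-st customer. -/
noncomputable def lindley (S T : ℕ → ℝ) : ℕ → ℝ
  | 0 => 0
  | i + 1 => max (lindley S T i + S i - T (i + 1)) 0

/-- The time which the `i`-th customer spends in the system. -/
noncomputable def sojourn (S T : ℕ → ℝ) (i : ℕ) : ℝ :=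
  lindley S T i + S i

/-- The sum of the martingale differences obtained from
`E[W (i + 1)] = λ / 2 * E[(W i + S i) ^ 2 - W (i + 1) ^ 2]`, which holds for interarrival times that
are exponential with rate `λ`, see `integral_max_sub_expMeasure`. -/
noncomputable def workloadNoise (lam : ℝ) (S T : ℕ → ℝ) (n : ℕ) : ℝ :=
  ∑ i ∈ Finset.range n,
    (lindley S T (i + 1) - lam / 2 * (sojourn S T i ^ 2 - lindley S T (i + 1) ^ 2))

/-- The sum of the martingale differences due to the independence of the waiting time and the
mark `c i` of a customer, where `m` is the mean of the mark. -/
noncomputable def markNoise (c : ℕ → ℝ) (m : ℝ) (S T : ℕ → ℝ) (n : ℕ) : ℝ :=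
  ∑ i ∈ Finset.range n, lindley S T (i + 1) * (c (i + 1) - m)

/-- The right-hand side of the energy identity, up to its boundary terms. -/
noncomputable def energy (lam s : ℝ) (S T : ℕ → ℝ) (n : ℕ) : ℝ :=
  lam / 2 * ∑ i ∈ Finset.range n, S i ^ 2 + workloadNoise lam S T n + lam * markNoise S s S T n

/-- The last customer up to the `n`-th one who finds the server idle. -/
noncomputable def lastIdle (S T : ℕ → ℝ) (n : ℕ) : ℕ :=
  open Classical in Nat.findGreatest (fun k => lindley S T k = 0) n

section Path

variable {S T : ℕ → ℝ}

lemma lindley_nonneg : ∀ i, 0 ≤ lindley S T i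
  | 0 => le_rfl
  | _ + 1 => le_max_right _ _

lemma sojourn_nonneg (hS : ∀ i, 0 ≤ S i) (i : ℕ) : 0 ≤ sojourn S T i :=
  add_nonneg (lindley_nonneg i) (hS i)

lemma sojourn_succ_le (hS : ∀ i, 0 ≤ S i) (hT : ∀ i, 0 ≤ T i) (i : ℕ) :
    sojourn S T (i + 1) ≤ sojourn S T i + S (i + 1) :=
  add_le_add_left (max_le (sub_le_self _ (hT _)) (sojourn_nonneg hS i)) _

lemma sq_le_sq_add_two_mul_sum {V s : ℕ → ℝ} (hV : ∀ i, 0 ≤ V i) (hs : 0 ≤ s 0)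
    (hstep : ∀ i, V (i + 1) ≤ V i + s (i + 1)) (i : ℕ) :
    V i ^ 2 ≤ V 0 ^ 2 + 2 * ∑ j ∈ Finset.range (i + 1), s j * V j := by
  induction i with
  | zero => simpa using mul_nonneg hs (hV 0)
  | succ i ih =>
    have := mul_le_mul_of_nonneg_left (hstep i) (hV (i + 1))
    rw [Finset.sum_range_succ]
    nlinarith [sq_nonneg (V (i + 1) - V i)]

lemma le_mul_sqrt_sqrt_pow {v w c A : ℝ} (hw : 0 ≤ w) (hc : 0 ≤ c) (hA : 1 ≤ A)
    (h : v ^ 2 ≤ w ^ 2 + 2 * (c * √A * A)) : v ≤ (w + c + 1) * √√A ^ 3 := by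
  have hcube : (√√A ^ 3) ^ 2 = √A * A := by
    calc (√√A ^ 3) ^ 2 = (√√A ^ 2) ^ 3 := by ring
      _ = √A * √A ^ 2 := by
        rw [Real.sq_sqrt (Real.sqrt_nonneg _)]
        ring
      _ = √A * A := by rw [Real.sq_sqrt (zero_le_one.trans hA)]
  have hone : 1 ≤ √A * A := one_le_mul_of_one_le_of_one_le (Real.one_le_sqrt.2 hA) hA
  refine le_of_sq_le_sq ?_ (by positivity)
  calc v ^ 2 ≤ w ^ 2 * (√A * A) + 2 * c * (√A * A) := by
        linarith [mul_le_mul_of_nonneg_left hone (sq_nonneg w)]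
    _ = (w ^ 2 + 2 * c) * (√A * A) := by ring
    _ ≤ (w + c + 1) ^ 2 * (√A * A) := by
        gcongr
        nlinarith [mul_nonneg hw hc, sq_nonneg c]
    _ = ((w + c + 1) * √√A ^ 3) ^ 2 := by rw [mul_pow, hcube]

lemma le_sqrt_mul_sqrt_normalizer {C : ℝ} (hS : ∀ i, 0 ≤ S i) (hC0 : 0 ≤ C)
    (hC : ∀ n : ℕ, ∑ i ∈ Finset.range n, S i ^ 2 ≤ C * n) {i j : ℕ} (hji : j ≤ i) :
    S j ≤ √C * √(normalizer (sojourn S T) i) := by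
  rw [← Real.sqrt_mul hC0]
  refine Real.le_sqrt_of_sq_le ?_
  calc S j ^ 2 ≤ ∑ k ∈ Finset.range (i + 1), S k ^ 2 :=
        Finset.single_le_sum (f := fun k => S k ^ 2) (fun _ _ => sq_nonneg _)
          (Finset.mem_range_succ_iff.2 hji)
    _ ≤ C * ((i + 1 : ℕ) : ℝ) := hC _
    _ ≤ C * normalizer (sojourn S T) i := by
      push_cast
      gcongr
      exact natCast_add_one_le_normalizer (sojourn_nonneg hS) i

/-- A single service time is `O(√n)`, so the recursion for the squares of the sojourn times gives
`V n ^ 2 = O(√n * ∑ V)`. -/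
lemma exists_one_add_sojourn_le (hS : ∀ i, 0 ≤ S i) (hT : ∀ i, 0 ≤ T i) {σ : ℝ}
    (hS2 : HasAverage (fun i => S i ^ 2) σ) :
    ∃ k, ∀ i, 1 + sojourn S T i ≤ k * √√(normalizer (sojourn S T) i) ^ 3 := by
  obtain ⟨C, hC0, hC⟩ := hS2.exists_sum_le_mul
  have hsoj : ∀ i, 0 ≤ 1 + sojourn S T i := fun i => add_nonneg zero_le_one (sojourn_nonneg hS i)
  refine ⟨1 + sojourn S T 0 + √C + 1, fun i => le_mul_sqrt_sqrt_pow (hsoj 0) (Real.sqrt_nonneg C)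
    (one_le_normalizer (sojourn_nonneg hS) i) ?_⟩
  have hsum : ∑ j ∈ Finset.range (i + 1), S j * (1 + sojourn S T j) ≤
      √C * √(normalizer (sojourn S T) i) * normalizer (sojourn S T) i :=
    (Finset.sum_le_sum fun j hj => mul_le_mul_of_nonneg_right
      (le_sqrt_mul_sqrt_normalizer hS hC0 hC (Finset.mem_range_succ_iff.1 hj)) (hsoj j)).trans_eq
      (Finset.mul_sum ..).symm
  calc (1 + sojourn S T i) ^ 2
      ≤ (1 + sojourn S T 0) ^ 2 +
          2 * ∑ j ∈ Finset.range (i + 1), S j * (1 + sojourn S T j) :=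
        sq_le_sq_add_two_mul_sum (V := fun i => 1 + sojourn S T i) hsoj (hS 0)
          (fun i => by linarith [sojourn_succ_le hS hT i]) i
    _ ≤ _ := by gcongr

lemma exists_sum_sq_div_normalizer_sojourn_le (hS : ∀ i, 0 ≤ S i) (hT : ∀ i, 0 ≤ T i) {σ : ℝ}
    (hS2 : HasAverage (fun i => S i ^ 2) σ) :
    ∃ C, ∀ n, ∑ i ∈ Finset.range n,
      ((1 + sojourn S T i) / normalizer (sojourn S T) i) ^ 2 ≤ C :=
  have ⟨_, hk⟩ := exists_one_add_sojourn_le hS hT hS2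
  exists_sum_sq_div_normalizer_le (sojourn_nonneg hS) hk

lemma normalizer_sojourn (n : ℕ) :
    normalizer (sojourn S T) n =
      (n + 1) + ∑ i ∈ Finset.range (n + 1), lindley S T i + ∑ i ∈ Finset.range (n + 1), S i := by
  simp [normalizer, sojourn, Finset.sum_add_distrib, add_assoc]

/-- The sum of the recursions for the squares of the waiting times. -/
lemma energy_identity (lam s : ℝ) (n : ℕ) :
    (1 - lam * s) * ∑ i ∈ Finset.range (n + 1), lindley S T i =
      energy lam s S T n - lam / 2 * lindley S T n ^ 2 - lam * (lindley S T n * S n) := by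
  induction n with
  | zero => simp [energy, workloadNoise, markNoise, lindley]
  | succ n ih =>
    rw [Finset.sum_range_succ, mul_add, ih]
    simp only [energy, workloadNoise, markNoise, sojourn, Finset.sum_range_succ]
    ring

lemma mul_sum_lindley_le_energy {lam : ℝ} (hlam : 0 ≤ lam) (s : ℝ) (hS : ∀ i, 0 ≤ S i) (n : ℕ) :
    (1 - lam * s) * ∑ i ∈ Finset.range (n + 1), lindley S T i ≤ energy lam s S T n := by
  have h1 := mul_nonneg hlam (mul_nonneg (lindley_nonneg (S := S) (T := T) n) (hS n))
  have h2 := mul_nonneg hlam (sq_nonneg (lindley S T n))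
  rw [energy_identity]
  linarith

lemma mul_sum_lindley_eq_energy {n : ℕ} (h : lindley S T n = 0) (lam s : ℝ) :
    (1 - lam * s) * ∑ i ∈ Finset.range (n + 1), lindley S T i = energy lam s S T n := by
  simp [energy_identity, h]

lemma normalizer_sojourn_isBigO {lam s a σ : ℝ} (hlam : 0 ≤ lam) (hρ : lam * s < 1)
    (hS : ∀ i, 0 ≤ S i) (hS1 : HasAverage S a) (hS2 : HasAverage (fun i => S i ^ 2) σ)
    (hM : workloadNoise lam S T =o[atTop] normalizer (sojourn S T))
    (hM' : markNoise S s S T =o[atTop] normalizer (sojourn S T)) :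
    normalizer (sojourn S T) =O[atTop] (fun n => (n : ℝ)) := by
  obtain ⟨C₁, hC₁0, hC₁⟩ := hS1.exists_sum_le_mul
  obtain ⟨C₂, _, hC₂⟩ := hS2.exists_sum_le_mul
  set r := 1 - lam * s
  have hr0 : 0 < r := sub_pos.2 hρ
  refine IsBigO.of_bound ((2 * r + 2 * r * C₁ + lam / 2 * C₂) / (r / 2)) ?_
  filter_upwards [(hM.add (hM'.const_mul_left lam)).bound (half_pos hr0),
    eventually_ge_atTop 1] with n hnoise hn
  have hn' : (1 : ℝ) ≤ n := by exact_mod_cast hn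
  have hA := normalizer_pos (sojourn_nonneg (T := T) hS) n
  rw [Real.norm_of_nonneg hA.le] at hnoise ⊢
  rw [Real.norm_of_nonneg n.cast_nonneg, div_mul_eq_mul_div, le_div_iff₀ (half_pos hr0)]
  have hW := mul_sum_lindley_le_energy (T := T) hlam s hS n
  have hS1n : r * ∑ i ∈ Finset.range (n + 1), S i ≤ r * (C₁ * (2 * n)) := by
    gcongr
    refine (hC₁ (n + 1)).trans ?_
    push_cast
    gcongr
    linarith
  have hS2n : lam / 2 * ∑ i ∈ Finset.range n, S i ^ 2 ≤ lam / 2 * (C₂ * n) := by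
    gcongr
    exact hC₂ n
  have hrn : r * (n + 1) ≤ r * (2 * n) := by
    gcongr
    linarith
  have hexp := congrArg (r * ·) (normalizer_sojourn (S := S) (T := T) n)
  simp only [mul_add] at hexp hrn
  simp only [energy] at hW
  linarith [(le_abs_self _).trans hnoise]

lemma lindley_eq_sub_lastIdle (n : ℕ) :
    lindley S T n = ∑ i ∈ Finset.range n, (S i - T (i + 1)) -
      ∑ i ∈ Finset.range (lastIdle S T n), (S i - T (i + 1)) := by
  classical
  induction n with
  | zero => simp [lastIdle, lindley]
  | succ n ih =>
    by_cases h : lindley S T (n + 1) = 0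
    · have hl : lastIdle S T (n + 1) = n + 1 := by simp [lastIdle, h]
      rw [hl, h, sub_self]
    · have hl : lastIdle S T (n + 1) = lastIdle S T n := by
        simp [lastIdle, h]
      have hW : lindley S T (n + 1) = lindley S T n + S n - T (n + 1) :=
        (max_choice _ _).resolve_right h
      rw [hl, hW, Finset.sum_range_succ]
      linarith

lemma lastIdle_le (n : ℕ) : lastIdle S T n ≤ n :=
  Nat.findGreatest_le n

lemma lindley_lastIdle (n : ℕ) : lindley S T (lastIdle S T n) = 0 := by
  classical exact Nat.findGreatest_spec (P := fun k => lindley S T k = 0) n.zero_le rfl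

end Path

lemma isLittleO_comp_of_le {g : ℕ → ℝ} (hg : g =o[atTop] (fun n : ℕ => (n : ℝ))) {l : ℕ → ℕ}
    (hl : ∀ n, l n ≤ n) : (fun n => g (l n)) =o[atTop] (fun n : ℕ => (n : ℝ)) := by
  rw [isLittleO_iff]
  intro ε hε
  obtain ⟨n₀, hn₀⟩ := eventually_atTop.1 (hg.bound (half_pos hε))
  set K := ∑ i ∈ Finset.range n₀, ‖g i‖
  have hK0 : 0 ≤ K := Finset.sum_nonneg fun _ _ => norm_nonneg _
  have hbound : ∀ n, ‖g n‖ ≤ ε / 2 * n + K := fun n => by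
    rcases lt_or_ge n n₀ with h | h
    · have := Finset.single_le_sum (f := fun i => ‖g i‖) (fun _ _ => norm_nonneg _)
        (Finset.mem_range.2 h)
      have : 0 ≤ ε / 2 * n := by positivity
      linarith
    · have := hn₀ n h
      rw [Real.norm_of_nonneg n.cast_nonneg] at this
      linarith
  have hlarge : ∀ᶠ n : ℕ in atTop, K ≤ ε / 2 * n :=
    (tendsto_natCast_atTop_atTop.const_mul_atTop (half_pos hε)).eventually_ge_atTop K
  filter_upwards [hlarge] with n hn
  have hln : ε / 2 * l n ≤ ε / 2 * n := by
    gcongr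
    exact hl n
  rw [Real.norm_of_nonneg n.cast_nonneg]
  linarith [hbound (l n)]

lemma tendsto_div_of_sum_sub_nonneg {f : ℕ → ℝ} {δ : ℝ} (hδ : 0 < δ) (hf : HasAverage f (-δ))
    {l : ℕ → ℕ} (hl : ∀ n, l n ≤ n)
    (hfl : ∀ n, ∑ i ∈ Finset.range (l n), f i ≤ ∑ i ∈ Finset.range n, f i) :
    Tendsto (fun n : ℕ => (l n : ℝ) / n) atTop (𝓝 1) := by
  set g : ℕ → ℝ := fun n => ∑ i ∈ Finset.range n, f i + δ * n with hg
  have hgo : g =o[atTop] (fun n : ℕ => (n : ℝ)) := by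
    refine (isLittleO_iff_tendsto fun n hn => by simp [hg, Nat.cast_eq_zero.1 hn]).2 ?_
    rw [← neg_add_cancel δ]
    refine (Tendsto.add_const δ hf).congr' ?_
    filter_upwards [eventually_ge_atTop 1] with n hn
    simp only [hg]
    field_simp
  have hdiff : (fun n : ℕ => (n : ℝ) - l n) =O[atTop] (fun n => g n - g (l n)) := by
    refine IsBigO.of_bound (1 / δ) (.of_forall fun n => ?_)
    have hln : (l n : ℝ) ≤ n := by exact_mod_cast hl n
    rw [Real.norm_of_nonneg (sub_nonneg.2 hln), one_div_mul_eq_div, le_div_iff₀ hδ]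
    refine le_trans ?_ (le_abs_self _)
    simp only [hg]
    linarith [hfl n]
  have hzero :=
    (hdiff.trans_isLittleO (hgo.sub (isLittleO_comp_of_le hgo hl))).tendsto_div_nhds_zero
  rw [← sub_zero (1 : ℝ)]
  refine (hzero.const_sub 1).congr' ?_
  filter_upwards [eventually_ge_atTop 1] with n hn
  field_simp
  ring

lemma tendsto_div_natCast_of_monotone_of_le {F H : ℕ → ℝ} {l : ℕ → ℕ} {h : ℝ} (hF : Monotone F)
    (hFH : ∀ n, F n ≤ H n) (hl : ∀ n, l n ≤ n) (hFHl : ∀ n, F (l n) = H (l n))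
    (hllim : Tendsto (fun n : ℕ => (l n : ℝ) / n) atTop (𝓝 1))
    (hH : Tendsto (fun n : ℕ => H n / n) atTop (𝓝 h)) :
    Tendsto (fun n : ℕ => F n / n) atTop (𝓝 h) := by
  have hcancel : ∀ᶠ n : ℕ in atTop, (l n : ℝ) / n * n = l n := by
    filter_upwards [eventually_ge_atTop 1] with n hn
    field_simp
  have hltop : Tendsto l atTop atTop := by
    rw [← tendsto_natCast_atTop_iff (R := ℝ)]
    exact (hllim.pos_mul_atTop one_pos tendsto_natCast_atTop_atTop).congr' hcancel
  have hHl : Tendsto (fun n : ℕ => H (l n) / n) atTop (𝓝 h) := by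
    rw [← mul_one h]
    refine ((hH.comp hltop).mul hllim).congr' ?_
    filter_upwards [hltop.eventually_ge_atTop 1] with n hn
    have : (l n : ℝ) ≠ 0 := by positivity
    simp only [Function.comp]
    field_simp
  refine tendsto_of_tendsto_of_tendsto_of_le_of_le hHl hH (fun n => ?_) (fun n => ?_)
  · exact div_le_div_of_nonneg_right (hFHl n ▸ hF (hl n)) n.cast_nonneg
  · exact div_le_div_of_nonneg_right (hFH n) n.cast_nonneg

lemma tendsto_lastIdle_div {S T : ℕ → ℝ} {s t : ℝ} (hst : s < t) (hS : HasAverage S s)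
    (hT : HasAverage (fun i => T (i + 1)) t) :
    Tendsto (fun n : ℕ => (lastIdle S T n : ℝ) / n) atTop (𝓝 1) := by
  refine tendsto_div_of_sum_sub_nonneg (sub_pos.2 hst) (f := fun i => S i - T (i + 1)) ?_
    lastIdle_le fun n => ?_
  · rw [neg_sub]
    refine (Tendsto.sub hS hT).congr fun n => ?_
    rw [Finset.sum_sub_distrib, sub_div]
  · linarith [lindley_eq_sub_lastIdle (S := S) (T := T) n, lindley_nonneg (S := S) (T := T) n]

/-- The boundary terms of the energy identity vanish at the customers who find the server idle, and
these are frequent enough for the monotone sums of the waiting times to be determined by them. -/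
lemma hasAverage_lindley {S T : ℕ → ℝ} {lam s σ : ℝ} (hlam : 0 < lam) (hρ : lam * s < 1)
    (hS : ∀ i, 0 ≤ S i) (hS1 : HasAverage S s) (hS2 : HasAverage (fun i => S i ^ 2) σ)
    (hT : HasAverage (fun i => T (i + 1)) (1 / lam))
    (hM : workloadNoise lam S T =o[atTop] normalizer (sojourn S T))
    (hM' : markNoise S s S T =o[atTop] normalizer (sojourn S T)) :
    HasAverage (lindley S T) (lam * σ / (2 * (1 - lam * s))) := by
  have hA := normalizer_sojourn_isBigO hlam.le hρ hS hS1 hS2 hM hM'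
  have hρ' : 0 < 1 - lam * s := sub_pos.2 hρ
  have henergy : Tendsto (fun n : ℕ => energy lam s S T n / n) atTop (𝓝 (lam / 2 * σ)) := by
    have hnoise := ((hM.add (hM'.const_mul_left lam)).trans_isBigO hA).tendsto_div_nhds_zero
    have := (Tendsto.const_mul (lam / 2) hS2).add hnoise
    rw [add_zero] at this
    refine this.congr fun n => ?_
    simp only [energy]
    ring
  have hmono : Monotone fun n => (1 - lam * s) * ∑ i ∈ Finset.range (n + 1), lindley S T i :=
    monotone_nat_of_le_succ fun n => by
      rw [Finset.sum_range_succ _ (n + 1)]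
      exact mul_le_mul_of_nonneg_left (le_add_of_nonneg_right (lindley_nonneg _)) hρ'.le
  have hst : s < 1 / lam := by rwa [lt_div_iff₀ hlam, mul_comm]
  have hlim := tendsto_div_natCast_of_monotone_of_le hmono
    (mul_sum_lindley_le_energy hlam.le s hS) lastIdle_le
    (fun n => mul_sum_lindley_eq_energy (lindley_lastIdle n) lam s)
    (tendsto_lastIdle_div hst hS1 hT) henergy
  refine hasAverage_of_tendsto_sum_range_succ ?_
  convert hlim.const_mul (1 - lam * s)⁻¹ using 1
  · ext n
    field_simp
  · congr 1
    field_simp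

lemma hasAverage_lindley_mul {S T c : ℕ → ℝ} {m w : ℝ} (hW : HasAverage (lindley S T) w)
    (hA : normalizer (sojourn S T) =O[atTop] (fun n => (n : ℝ)))
    (hM : markNoise c m S T =o[atTop] normalizer (sojourn S T)) :
    HasAverage (fun i => lindley S T i * c i) (m * w) := by
  have hcentred : HasAverage (fun i => lindley S T i * (c i - m)) 0 := by
    refine hasAverage_of_tendsto_sum_range_succ ?_
    refine (hM.trans_isBigO hA).tendsto_div_nhds_zero.congr fun n => ?_
    simp [Finset.sum_range_succ', markNoise, lindley]
  have hsum := Tendsto.add hcentred (Tendsto.const_mul m hW)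
  rw [zero_add] at hsum
  refine hsum.congr fun n => ?_
  rw [← mul_div_assoc, ← add_div, Finset.mul_sum, ← Finset.sum_add_distrib]
  congr! 2 with i
  ring

/-! ### A law of large numbers for martingales -/

section Martingale

variable {Ω : Type*} {mΩ : MeasurableSpace Ω} {μ : Measure Ω}

lemma integral_sq_sum_of_condExp_eq_zero [IsFiniteMeasure μ] {𝒢 : Filtration ℕ mΩ}
    {d : ℕ → Ω → ℝ} (hd : ∀ i, StronglyMeasurable[𝒢 (i + 1)] (d i)) (hL2 : ∀ i, MemLp (d i) 2 μ)
    (hc : ∀ i, μ[d i | 𝒢 i] =ᵐ[μ] 0) (n : ℕ) :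
    ∫ ω, (∑ i ∈ Finset.range n, d i ω) ^ 2 ∂μ = ∑ i ∈ Finset.range n, ∫ ω, d i ω ^ 2 ∂μ := by
  induction n with
  | zero => simp
  | succ n ih =>
    set M : Ω → ℝ := fun ω => ∑ i ∈ Finset.range n, d i ω
    have hMn : StronglyMeasurable[𝒢 n] M := by
      refine Finset.stronglyMeasurable_fun_sum _ fun i hi => (hd i).mono (𝒢.mono ?_)
      exact Finset.mem_range.1 hi
    have hM2 : MemLp M 2 μ := memLp_finsetSum _ fun i _ => hL2 i
    have hMd : Integrable (M * d n) μ := hM2.integrable_mul (hL2 n)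
    have horth : ∫ ω, M ω * d n ω ∂μ = 0 := by
      change ∫ ω, (M * d n) ω ∂μ = 0
      rw [← integral_condExp (𝒢.le n)]
      refine integral_eq_zero_of_ae ?_
      filter_upwards [hc n, condExp_mul_of_stronglyMeasurable_left hMn hMd
        ((hL2 n).integrable one_le_two)] with ω h h'
      rw [h', Pi.mul_apply, h, Pi.zero_apply, mul_zero]
    calc ∫ ω, (∑ i ∈ Finset.range (n + 1), d i ω) ^ 2 ∂μ
        = ∫ ω, (M ω ^ 2 + 2 * (M ω * d n ω) + d n ω ^ 2) ∂μ := by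
          congr! 2 with ω
          rw [Finset.sum_range_succ]
          ring
      _ = ∫ ω, M ω ^ 2 ∂μ + 2 * ∫ ω, M ω * d n ω ∂μ + ∫ ω, d n ω ^ 2 ∂μ := by
          have hMd' : Integrable (fun ω => 2 * (M ω * d n ω)) μ := hMd.const_mul 2
          have hsum : Integrable (fun ω => M ω ^ 2 + 2 * (M ω * d n ω)) μ :=
            hM2.integrable_sq.add hMd'
          rw [integral_add hsum (hL2 n).integrable_sq, integral_add hM2.integrable_sq hMd',
            integral_const_mul]
      _ = ∑ i ∈ Finset.range (n + 1), ∫ ω, d i ω ^ 2 ∂μ := by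
          rw [ih, horth, Finset.sum_range_succ]
          ring

lemma ae_exists_tendsto_sum_of_condExp_eq_zero [IsProbabilityMeasure μ] {𝒢 : Filtration ℕ mΩ}
    {d : ℕ → Ω → ℝ} {K : ℝ} (hd : ∀ i, StronglyMeasurable[𝒢 (i + 1)] (d i))
    (hL2 : ∀ i, MemLp (d i) 2 μ) (hc : ∀ i, μ[d i | 𝒢 i] =ᵐ[μ] 0)
    (hK : ∀ n, ∑ i ∈ Finset.range n, ∫ ω, d i ω ^ 2 ∂μ ≤ K) :
    ∀ᵐ ω ∂μ, ∃ s, Tendsto (fun n => ∑ i ∈ Finset.range n, d i ω) atTop (𝓝 s) := by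
  set M : ℕ → Ω → ℝ := fun n ω => ∑ i ∈ Finset.range n, d i ω with hM
  have hM2 : ∀ n, MemLp (M n) 2 μ := fun n => memLp_finsetSum _ fun i _ => hL2 i
  have hint : ∀ n, Integrable (M n) μ := fun n => (hM2 n).integrable one_le_two
  have hmart : Martingale M 𝒢 μ := by
    refine martingale_of_condExp_sub_eq_zero_nat (fun n => ?_) hint fun n => ?_
    · refine Finset.stronglyMeasurable_fun_sum _ fun i hi => (hd i).mono (𝒢.mono ?_)
      exact Finset.mem_range.1 hi
    · have : M (n + 1) - M n = d n := by
        ext ω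
        simp [hM, Finset.sum_range_succ]
      rw [this]
      exact hc n
  have hbdd : ∀ n, eLpNorm (M n) 1 μ ≤ (Real.toNNReal (1 + K) : ENNReal) := by
    intro n
    rw [eLpNorm_one_eq_lintegral_enorm, ← ofReal_integral_norm_eq_lintegral_enorm (hint n)]
    refine ENNReal.ofReal_le_ofReal ?_
    have hsq : ∀ a : ℝ, ‖a‖ ≤ 1 + a ^ 2 := fun a => by
      rw [Real.norm_eq_abs]
      nlinarith [sq_abs a, sq_nonneg (|a| - 1)]
    calc ∫ ω, ‖M n ω‖ ∂μ ≤ ∫ ω, (1 + M n ω ^ 2) ∂μ :=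
          integral_mono (hint n).norm ((integrable_const 1).add (hM2 n).integrable_sq)
            fun ω => hsq _
      _ = 1 + ∫ ω, M n ω ^ 2 ∂μ := by
          rw [integral_add (integrable_const 1) (hM2 n).integrable_sq]
          simp
      _ ≤ 1 + K := by
          rw [integral_sq_sum_of_condExp_eq_zero hd hL2 hc]
          linarith [hK n]
  exact hmart.submartingale.exists_ae_tendsto_of_bdd hbdd

variable {F α : Type*} [MeasurableSpace F] [MeasurableSpace α]

lemma map_prodMk_eq_prod_of_indepFun [IsFiniteMeasure μ] {Y : Ω → α} {ξ : Ω → F} {Q : Measure F}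
    (hY : Measurable Y) (hξ : Measurable ξ) (hind : IndepFun Y ξ μ) (hlaw : μ.map ξ = Q) :
    μ.map (fun ω => (Y ω, ξ ω)) = (μ.map Y).prod Q := by
  rw [(indepFun_iff_map_prod_eq_prod_map_map hY.aemeasurable hξ.aemeasurable).1 hind, hlaw]

lemma lintegral_comp_prodMk_of_indepFun [IsFiniteMeasure μ] {Y : Ω → α} {ξ : Ω → F}
    {Q : Measure F} [SFinite Q] (hY : Measurable Y) (hξ : Measurable ξ) (hind : IndepFun Y ξ μ)
    (hlaw : μ.map ξ = Q) {f : α × F → ENNReal} (hf : Measurable f) :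
    ∫⁻ ω, f (Y ω, ξ ω) ∂μ = ∫⁻ ω, ∫⁻ z, f (Y ω, z) ∂Q ∂μ := by
  rw [← lintegral_map hf (hY.prodMk hξ), map_prodMk_eq_prod_of_indepFun hY hξ hind hlaw,
    lintegral_prod _ hf.aemeasurable, lintegral_map hf.lintegral_prod_right' hY]

lemma integral_comp_prodMk_of_indepFun [IsFiniteMeasure μ] {Y : Ω → α} {ξ : Ω → F}
    {Q : Measure F} [SFinite Q] (hY : Measurable Y) (hξ : Measurable ξ) (hind : IndepFun Y ξ μ)
    (hlaw : μ.map ξ = Q) {f : α × F → ℝ} (hf : Measurable f)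
    (hint : Integrable (fun ω => f (Y ω, ξ ω)) μ) :
    ∫ ω, f (Y ω, ξ ω) ∂μ = ∫ ω, ∫ z, f (Y ω, z) ∂Q ∂μ := by
  have hm := (hY.prodMk hξ).aemeasurable (μ := μ)
  have hmap := map_prodMk_eq_prod_of_indepFun hY hξ hind hlaw
  have hint' := (integrable_map_measure hf.aestronglyMeasurable hm).2 hint
  rw [hmap] at hint'
  rw [← integral_map hm hf.aestronglyMeasurable, hmap, integral_prod _ hint',
    integral_map (f := fun y => ∫ z, f (y, z) ∂Q) hY.aemeasurable
      hf.stronglyMeasurable.integral_prod_right'.aestronglyMeasurable]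

lemma condExp_comp_eq_zero_of_indep {Ω : Type*} {m mΩ : MeasurableSpace Ω} {μ : Measure Ω}
    [IsFiniteMeasure μ] (hm : m ≤ mΩ) {Y : Ω → α} {ξ : Ω → F} {Q : Measure F} [SFinite Q]
    (hY : Measurable[m] Y) (hξ : Measurable ξ)
    (hind : Indep m (MeasurableSpace.comap ξ inferInstance) μ) (hlaw : μ.map ξ = Q)
    {f : α × F → ℝ} (hf : Measurable f)
    (hint : Integrable (fun ω => f (Y ω, ξ ω)) μ) (h0 : ∀ ω, ∫ z, f (Y ω, z) ∂Q = 0) :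
    μ[fun ω => f (Y ω, ξ ω) | m] =ᵐ[μ] 0 := by
  symm
  refine ae_eq_condExp_of_forall_setIntegral_eq hm hint (fun s _ _ => integrableOn_zero)
    (fun s hs _ => ?_) stronglyMeasurable_zero.aestronglyMeasurable
  set g : Ω → ℝ := s.indicator 1 with hg
  have hgY : Measurable[m] (fun ω => (g ω, Y ω)) :=
    Measurable.prodMk ((@measurable_const ℝ Ω _ m 1).indicator hs) hY
  have hgYξ : IndepFun (fun ω => (g ω, Y ω)) ξ μ :=
    (IndepFun_iff_Indep _ _ _).2 (indep_of_indep_of_le_left hind hgY.comap_le)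
  have hindicator : s.indicator (fun ω => f (Y ω, ξ ω)) = fun ω => g ω * f (Y ω, ξ ω) := by
    ext ω
    by_cases h : ω ∈ s <;> simp [hg, h]
  have hset : ∫ ω, g ω * f (Y ω, ξ ω) ∂μ = ∫ ω, ∫ z, g ω * f (Y ω, z) ∂Q ∂μ :=
    integral_comp_prodMk_of_indepFun (hgY.mono hm le_rfl) hξ hgYξ hlaw
      (f := fun p => p.1.1 * f (p.1.2, p.2)) (by fun_prop)
      (by simpa only [hindicator] using hint.indicator (hm s hs))
  rw [Pi.zero_def, integral_zero, ← integral_indicator (hm s hs), hindicator, hset]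
  simp_rw [integral_const_mul, h0, mul_zero, integral_zero]

variable [IsProbabilityMeasure μ] {𝒢 : Filtration ℕ mΩ} {ξ : ℕ → Ω → F} {Q : Measure F} [SFinite Q]

lemma ae_exists_tendsto_sum_of_indep (hξ : ∀ i, Measurable[𝒢 (i + 1)] (ξ i))
    (hind : ∀ i, Indep (𝒢 i) (MeasurableSpace.comap (ξ i) inferInstance) μ)
    (hlaw : ∀ i, μ.map (ξ i) = Q) {Y : ℕ → Ω → α} (hY : ∀ i, Measurable[𝒢 i] (Y i))
    {f : α × F → ℝ} (hf : Measurable f) (h0 : ∀ i ω, ∫ z, f (Y i ω, z) ∂Q = 0) {K : ℝ}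
    (hK : ∀ n ω, ∑ i ∈ Finset.range n, ∫⁻ z, ENNReal.ofReal (f (Y i ω, z) ^ 2) ∂Q ≤
      ENNReal.ofReal K) :
    ∀ᵐ ω ∂μ, ∃ s, Tendsto (fun n => ∑ i ∈ Finset.range n, f (Y i ω, ξ i ω)) atTop (𝓝 s) := by
  set d : ℕ → Ω → ℝ := fun i ω => f (Y i ω, ξ i ω) with hd
  have hξm : ∀ i, Measurable (ξ i) := fun i => (hξ i).mono (𝒢.le _) le_rfl
  have hYm : ∀ i, Measurable (Y i) := fun i => (hY i).mono (𝒢.le i) le_rfl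
  have hdm : ∀ i, Measurable[𝒢 (i + 1)] (d i) := fun i =>
    hf.comp (((hY i).mono (𝒢.mono i.le_succ) le_rfl).prodMk (hξ i))
  have hdm' : ∀ i, Measurable (d i) := fun i => (hdm i).mono (𝒢.le _) le_rfl
  have hYξ : ∀ i, IndepFun (Y i) (ξ i) μ := fun i =>
    (IndepFun_iff_Indep _ _ _).2 (indep_of_indep_of_le_left (hind i) (hY i).comap_le)
  have hsum : ∀ n, ∑ i ∈ Finset.range n, ∫⁻ ω, ENNReal.ofReal (d i ω ^ 2) ∂μ ≤
      ENNReal.ofReal K := by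
    intro n
    have hf2 : Measurable fun p => ENNReal.ofReal (f p ^ 2) := by fun_prop
    simp_rw [hd, fun i => lintegral_comp_prodMk_of_indepFun (hYm i) (hξm i) (hYξ i) (hlaw i) hf2]
    have hint : ∀ i, Measurable fun ω => ∫⁻ z, ENNReal.ofReal (f (Y i ω, z) ^ 2) ∂Q := fun i =>
      hf2.lintegral_prod_right'.comp (hYm i)
    rw [← lintegral_finsetSum _ fun i _ => hint i]
    exact (lintegral_mono (hK n)).trans_eq (by simp)
  have hsq : ∀ i, Integrable (fun ω => d i ω ^ 2) μ := by
    refine fun i => ⟨((hdm' i).pow_const 2).aestronglyMeasurable, ?_⟩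
    rw [hasFiniteIntegral_iff_ofReal (ae_of_all _ fun ω => sq_nonneg _)]
    refine (le_trans ?_ (hsum (i + 1))).trans_lt ENNReal.ofReal_lt_top
    exact Finset.single_le_sum (f := fun i => ∫⁻ ω, ENNReal.ofReal (d i ω ^ 2) ∂μ)
      (fun _ _ => zero_le) (Finset.self_mem_range_succ i)
  have hL2 : ∀ i, MemLp (d i) 2 μ := fun i =>
    (memLp_two_iff_integrable_sq (hdm' i).aestronglyMeasurable).2 (hsq i)
  refine ae_exists_tendsto_sum_of_condExp_eq_zero (K := max K 0)
    (fun i => (hdm i).stronglyMeasurable) hL2 (fun i => condExp_comp_eq_zero_of_indep (𝒢.le i)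
      (hY i) (hξm i) (hind i) (hlaw i) hf ((hL2 i).integrable one_le_two) (h0 i)) fun n => ?_
  rw [← ENNReal.ofReal_le_ofReal_iff (le_max_right _ _), ENNReal.ofReal_max, ENNReal.ofReal_zero,
    ENNReal.ofReal_sum_of_nonneg fun i _ => integral_nonneg fun ω => sq_nonneg _]
  calc ∑ i ∈ Finset.range n, ENNReal.ofReal (∫ ω, d i ω ^ 2 ∂μ)
      = ∑ i ∈ Finset.range n, ∫⁻ ω, ENNReal.ofReal (d i ω ^ 2) ∂μ :=
        Finset.sum_congr rfl fun i _ =>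
          ofReal_integral_eq_lintegral_ofReal (hsq i) (ae_of_all _ fun ω => sq_nonneg _)
    _ ≤ max (ENNReal.ofReal K) 0 := (hsum n).trans (le_max_left _ _)

lemma sum_ite_partialSum_le {r : ℕ → ℝ} {c : ℝ} (hr : ∀ i, 0 ≤ r i) (hc : 0 ≤ c) (n : ℕ) :
    ∑ i ∈ Finset.range n, (if ∑ j ∈ Finset.range (i + 1), r j ≤ c then r i else 0) ≤ c := by
  induction n with
  | zero => simpa
  | succ n ih =>
    rw [Finset.sum_range_succ]
    split_ifs with h
    · refine le_trans ?_ h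
      rw [Finset.sum_range_succ]
      gcongr with i
      split_ifs
      · exact le_rfl
      · exact hr i
    · simpa using ih

/-- The weights `1 / normalizer u i`, set to `0` as soon as the squares of the weighted increments
`1 + u j` have a sum larger than `c`. -/
noncomputable def stoppedWeight (c : ℝ) (u : ℕ → ℝ) (i : ℕ) : ℝ :=
  if ∑ j ∈ Finset.range (i + 1), ((1 + u j) / normalizer u j) ^ 2 ≤ c then (normalizer u i)⁻¹
  else 0

lemma sum_sq_stoppedWeight_le {c : ℝ} (hc : 0 ≤ c) (u : ℕ → ℝ) (n : ℕ) :
    ∑ i ∈ Finset.range n, (stoppedWeight c u i * (1 + u i)) ^ 2 ≤ c := by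
  refine le_trans (Finset.sum_le_sum fun i _ => le_of_eq ?_)
    (sum_ite_partialSum_le (r := fun i => ((1 + u i) / normalizer u i) ^ 2)
      (fun i => sq_nonneg _) hc n)
  simp only [stoppedWeight]
  split_ifs <;> ring

lemma measurable_normalizer {u : ℕ → Ω → ℝ} (hu : ∀ i, Measurable[𝒢 i] (u i)) (n : ℕ) :
    Measurable[𝒢 n] fun ω => normalizer (u · ω) n :=
  Finset.measurable_fun_sum _ fun j hj => measurable_const.add
    ((hu j).mono (𝒢.mono (Finset.mem_range_succ_iff.1 hj)) le_rfl)

lemma measurable_stoppedWeight {u : ℕ → Ω → ℝ} (hu : ∀ i, Measurable[𝒢 i] (u i)) (c : ℝ) (i : ℕ) :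
    Measurable[𝒢 i] fun ω => stoppedWeight c (u · ω) i := by
  refine Measurable.ite (measurableSet_le ?_ measurable_const) (measurable_normalizer hu i).inv
    measurable_const
  refine Finset.measurable_fun_sum _ fun j hj => Measurable.mono ?_
    (𝒢.mono (Finset.mem_range_succ_iff.1 hj)) le_rfl
  exact ((measurable_const.add (hu j)).div (measurable_normalizer hu j)).pow_const 2

/-- By Kronecker's lemma it is enough that the increments divided by `normalizer u i` have a
convergent sum, and this holds for the stopped weights. -/
lemma ae_sum_isLittleO_normalizer (hξ : ∀ i, Measurable[𝒢 (i + 1)] (ξ i))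
    (hind : ∀ i, Indep (𝒢 i) (MeasurableSpace.comap (ξ i) inferInstance) μ)
    (hlaw : ∀ i, μ.map (ξ i) = Q) {u : ℕ → Ω → ℝ} (hu : ∀ i, Measurable[𝒢 i] (u i))
    (hu0 : ∀ i ω, 0 ≤ u i ω) {ψ : ℝ × F → ℝ} (hψ : Measurable ψ)
    (h0 : ∀ v, 0 ≤ v → ∫ z, ψ (v, z) ∂Q = 0) {C : ℝ} (hC : 0 ≤ C)
    (h2 : ∀ v, 0 ≤ v → ∫⁻ z, ENNReal.ofReal (ψ (v, z) ^ 2) ∂Q ≤ ENNReal.ofReal (C * (1 + v) ^ 2))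
    (hsum : ∀ᵐ ω ∂μ, ∃ c : ℝ, ∀ n, ∑ i ∈ Finset.range n,
      ((1 + u i ω) / normalizer (u · ω) i) ^ 2 ≤ c) :
    ∀ᵐ ω ∂μ, (fun n : ℕ => ∑ i ∈ Finset.range n, ψ (u i ω, ξ i ω)) =o[atTop]
      normalizer (u · ω) := by
  have hstopped : ∀ c : ℕ, ∀ᵐ ω ∂μ, ∃ s, Tendsto (fun n => ∑ i ∈ Finset.range n,
      stoppedWeight c (u · ω) i * ψ (u i ω, ξ i ω)) atTop (𝓝 s) := by
    intro c
    refine ae_exists_tendsto_sum_of_indep (K := C * c) hξ hind hlaw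
      (fun i => (measurable_stoppedWeight hu c i).prodMk (hu i))
      (f := fun p => p.1.1 * ψ (p.1.2, p.2)) (by fun_prop)
      (fun i ω => by rw [integral_const_mul, h0 _ (hu0 i ω), mul_zero]) fun n ω => ?_
    calc ∑ i ∈ Finset.range n,
          ∫⁻ z, ENNReal.ofReal ((stoppedWeight c (u · ω) i * ψ (u i ω, z)) ^ 2) ∂Q
        ≤ ∑ i ∈ Finset.range n,
            ENNReal.ofReal (C * (stoppedWeight c (u · ω) i * (1 + u i ω)) ^ 2) := by
          refine Finset.sum_le_sum fun i _ => ?_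
          simp_rw [mul_pow, ENNReal.ofReal_mul (sq_nonneg (stoppedWeight _ _ _))]
          rw [lintegral_const_mul _ (by fun_prop), mul_left_comm,
            ENNReal.ofReal_mul (sq_nonneg (stoppedWeight _ _ _))]
          gcongr
          exact h2 _ (hu0 i ω)
      _ = ENNReal.ofReal (C * ∑ i ∈ Finset.range n,
            (stoppedWeight c (u · ω) i * (1 + u i ω)) ^ 2) := by
          rw [← ENNReal.ofReal_sum_of_nonneg fun i _ => by positivity, Finset.mul_sum]
      _ ≤ ENNReal.ofReal (C * c) := by
          gcongr
          exact sum_sq_stoppedWeight_le c.cast_nonneg _ n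
  filter_upwards [ae_all_iff.2 hstopped, hsum] with ω hω ⟨c, hc⟩
  obtain ⟨k, hk⟩ := exists_nat_ge c
  obtain ⟨s, hs⟩ := hω k
  refine (isLittleO_sum_mul_of_tendsto_sum (monotone_normalizer (hu0 · ω))
    (tendsto_normalizer_atTop (hu0 · ω)) hs).congr_left fun n => Finset.sum_congr rfl fun i _ => ?_
  rw [stoppedWeight, if_pos ((hc (i + 1)).trans hk), mul_inv_cancel_left₀]
  exact (normalizer_pos (hu0 · ω) i).ne'

end Martingale

/-! ### The exponential distribution -/

lemma expMeasure_eq_withDensity (r : ℝ) :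
    expMeasure r = (volume.restrict (Set.Ioi 0)).withDensity
      (fun x => ENNReal.ofReal (r * Real.exp (-(r * x)))) := by
  rw [Measure.restrict_congr_set Ioi_ae_eq_Ici, ← withDensity_indicator measurableSet_Ici]
  change volume.withDensity (exponentialPDF r) = _
  congr 1
  ext x
  by_cases hx : 0 ≤ x <;> simp [exponentialPDF_eq, hx]

lemma lintegral_expMeasure (r : ℝ) {f : ℝ → ENNReal} (hf : Measurable f) :
    ∫⁻ x, f x ∂expMeasure r =
      ∫⁻ x in Set.Ioi 0, ENNReal.ofReal (r * Real.exp (-(r * x))) * f x := by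
  rw [expMeasure_eq_withDensity, lintegral_withDensity_eq_lintegral_mul _ (by fun_prop) hf]
  rfl

lemma integral_expMeasure {r : ℝ} (hr : 0 ≤ r) (f : ℝ → ℝ) :
    ∫ x, f x ∂expMeasure r = ∫ x in Set.Ioi 0, r * Real.exp (-(r * x)) * f x := by
  rw [expMeasure_eq_withDensity,
    integral_withDensity_eq_integral_toReal_smul (by fun_prop) (by simp)]
  congr! 2 with x
  rw [ENNReal.toReal_ofReal (by positivity), smul_eq_mul]

lemma integrable_expMeasure_iff {r : ℝ} (hr : 0 ≤ r) {f : ℝ → ℝ} :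
    Integrable f (expMeasure r) ↔
      IntegrableOn (fun x => r * Real.exp (-(r * x)) * f x) (Set.Ioi 0) := by
  rw [expMeasure_eq_withDensity,
    integrable_withDensity_iff_integrable_smul' (by fun_prop) (by simp), IntegrableOn]
  congr! 2 with x
  rw [ENNReal.toReal_ofReal (by positivity), smul_eq_mul]

lemma ae_pos_expMeasure (r : ℝ) : ∀ᵐ x ∂expMeasure r, 0 < x := by
  rw [expMeasure_eq_withDensity]
  exact (withDensity_absolutelyContinuous _ _).ae_le (ae_restrict_mem measurableSet_Ioi)

lemma lintegral_exp_neg_mul_expMeasure {a b : ℝ} (ha : 0 < a) (hb : 0 ≤ b) {f : ℝ → ENNReal}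
    (hf : Measurable f) :
    ∫⁻ x, ENNReal.ofReal (Real.exp (-(b * x))) * f x ∂expMeasure a =
      ENNReal.ofReal (a / (a + b)) * ∫⁻ x, f x ∂expMeasure (a + b) := by
  rw [lintegral_expMeasure _ (by fun_prop), lintegral_expMeasure _ hf,
    ← lintegral_const_mul _ (by fun_prop)]
  congr! 2 with x
  have hdensity : a * Real.exp (-(a * x)) * Real.exp (-(b * x)) =
      a / (a + b) * ((a + b) * Real.exp (-((a + b) * x))) := by
    have : a + b ≠ 0 := by positivity
    rw [mul_assoc, ← Real.exp_add]
    field_simp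
    ring_nf
  rw [← mul_assoc, ← mul_assoc, ← ENNReal.ofReal_mul (by positivity),
    ← ENNReal.ofReal_mul (by positivity), hdensity]

lemma setLIntegral_Ioi_expMeasure (r : ℝ) {t : ℝ} (ht : 0 ≤ t) {f : ℝ → ENNReal}
    (hf : Measurable f) :
    ∫⁻ x in Set.Ioi t, f (x - t) ∂expMeasure r =
      ENNReal.ofReal (Real.exp (-(r * t))) * ∫⁻ x, f x ∂expMeasure r := by
  rw [← lintegral_indicator measurableSet_Ioi,
    lintegral_expMeasure _ (Measurable.indicator (by fun_prop) measurableSet_Ioi),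
    lintegral_expMeasure _ hf, ← lintegral_const_mul _ (by fun_prop),
    ← lintegral_indicator measurableSet_Ioi, ← lintegral_indicator measurableSet_Ioi,
    ← lintegral_add_right_eq_self _ t]
  refine lintegral_congr fun x => ?_
  by_cases hx : 0 < x
  · have hxt : 0 < x + t := by positivity
    have htx : t < x + t := lt_add_of_pos_left _ hx
    have hdensity : r * Real.exp (-(r * (x + t))) =
        Real.exp (-(r * t)) * (r * Real.exp (-(r * x))) := by
      rw [mul_left_comm, ← Real.exp_add]
      ring_nf
    simp only [Set.indicator, Set.mem_Ioi, hx, hxt, htx, if_true, add_sub_cancel_right]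
    rw [← mul_assoc, ← ENNReal.ofReal_mul (by positivity), hdensity]
  · simp [hx]

lemma integrable_pow_expMeasure {r : ℝ} (hr : 0 < r) (k : ℕ) :
    Integrable (fun x => x ^ k) (expMeasure r) := by
  rw [integrable_expMeasure_iff hr.le]
  have hk : (-1 : ℝ) < k := neg_one_lt_zero.trans_le k.cast_nonneg
  refine IntegrableOn.congr_fun
    ((integrableOn_rpow_mul_exp_neg_mul_rpow hk one_pos hr).const_mul r) (fun x _ => ?_)
    measurableSet_Ioi
  simp only [Real.rpow_natCast, Real.rpow_one]
  ring_nf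

lemma integral_id_expMeasure {r : ℝ} (hr : 0 < r) : ∫ x, x ∂expMeasure r = 1 / r := by
  have hGamma := Real.integral_rpow_mul_exp_neg_mul_Ioi two_pos hr
  rw [Real.Gamma_two, mul_one] at hGamma
  calc ∫ x, x ∂expMeasure r
      = ∫ x in Set.Ioi 0, r * (x ^ ((2 : ℝ) - 1) * Real.exp (-(r * x))) := by
        rw [integral_expMeasure hr.le]
        congr! 2 with x
        rw [show (2 : ℝ) - 1 = 1 by norm_num, Real.rpow_one]
        ring
    _ = r * (1 / r) ^ 2 := by
        rw [integral_const_mul, hGamma, Real.rpow_two]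
    _ = 1 / r := by
        field_simp

lemma intervalIntegral_exp_mul_sub_add_sq (r u : ℝ) :
    ∫ x in (0 : ℝ)..u, r * Real.exp (-(r * x)) * ((u - x) + r / 2 * (u - x) ^ 2) =
      r / 2 * u ^ 2 := by
  rw [intervalIntegral.integral_eq_sub_of_hasDerivAt
    (f := fun x => -(r / 2) * ((u - x) ^ 2 * Real.exp (-(r * x))))]
  · simp
  · intro x _
    have hsq : HasDerivAt (fun x : ℝ => (u - x) ^ 2) (2 * (u - x) * (-1)) x := by
      have := ((hasDerivAt_id x).const_sub u).pow 2
      simp only [Nat.cast_ofNat, Nat.add_one_sub_one, pow_one] at this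
      exact this
    have hexp : HasDerivAt (fun x : ℝ => Real.exp (-(r * x)))
        (Real.exp (-(r * x)) * (-(r * 1))) x :=
      ((hasDerivAt_id x).const_mul r).neg.exp
    convert! (hsq.mul hexp).const_mul (-(r / 2)) using 1
    ring
  · exact Continuous.intervalIntegrable (by fun_prop) _ _

lemma integral_max_sub_add_sq_expMeasure {r u : ℝ} (hr : 0 ≤ r) (hu : 0 ≤ u) :
    ∫ x, (max (u - x) 0 + r / 2 * max (u - x) 0 ^ 2) ∂expMeasure r = r / 2 * u ^ 2 := by
  rw [integral_expMeasure hr, ← intervalIntegral_exp_mul_sub_add_sq,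
    intervalIntegral.integral_of_le hu, setIntegral_eq_of_subset_of_forall_sdiff_eq_zero
      (s := Set.Ioc 0 u) measurableSet_Ioi Set.Ioc_subset_Ioi_self]
  · refine setIntegral_congr_fun measurableSet_Ioc fun x hx => ?_
    simp only [max_eq_left (sub_nonneg.2 hx.2)]
  · rintro x ⟨hx0, hxu⟩
    have hux : u ≤ x := by
      by_contra! h
      exact hxu ⟨hx0, h.le⟩
    simp [max_eq_right (sub_nonpos.2 hux)]

/-- A workload `u` drained during an exponential time leaves `max (u - x) 0`. -/
lemma integral_max_sub_expMeasure {r u : ℝ} (hr : 0 < r) (hu : 0 ≤ u) :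
    ∫ x, (max (u - x) 0 - r / 2 * (u ^ 2 - max (u - x) 0 ^ 2)) ∂expMeasure r = 0 := by
  have := isProbabilityMeasure_expMeasure hr
  have hint : Integrable (fun x => max (u - x) 0 + r / 2 * max (u - x) 0 ^ 2) (expMeasure r) := by
    refine Integrable.of_bound (C := u + r / 2 * u ^ 2) (by fun_prop) ?_
    filter_upwards [ae_pos_expMeasure r] with x hx
    have hle : max (u - x) 0 ≤ u := max_le (sub_le_self _ hx.le) hu
    rw [Real.norm_of_nonneg (by positivity)]
    gcongr
  calc ∫ x, (max (u - x) 0 - r / 2 * (u ^ 2 - max (u - x) 0 ^ 2)) ∂expMeasure r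
      = ∫ x, ((max (u - x) 0 + r / 2 * max (u - x) 0 ^ 2) - r / 2 * u ^ 2) ∂expMeasure r := by
        congr! 2 with x
        ring
    _ = 0 := by
        rw [integral_sub hint (integrable_const _), integral_max_sub_add_sq_expMeasure hr.le hu]
        simp

/-! ### Sequences of independent variables -/

section Sequences

variable {α : Type*}

/-- Put an element in front of a sequence. -/
def streamCons (p : α × (ℕ → α)) : ℕ → α
  | 0 => p.1
  | j + 1 => p.2 j

lemma streamCons_preimage_pi_range (n : ℕ) (t : ℕ → Set α) :
    streamCons ⁻¹' Set.pi (Finset.range (n + 1)) t =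
      t 0 ×ˢ Set.pi (Finset.range n) (fun j => t (j + 1)) := by
  ext ⟨z, f⟩
  simp only [Set.mem_preimage, Set.mem_pi, Set.mem_prod, Finset.coe_range, Set.mem_Iio]
  constructor
  · exact fun h => ⟨h 0 n.succ_pos, fun j hj => h (j + 1) (Nat.succ_lt_succ hj)⟩
  · rintro ⟨h0, h⟩ (_ | j) hj
    exacts [h0, h j (Nat.lt_of_succ_lt_succ hj)]

variable [MeasurableSpace α]

lemma measurable_streamCons : Measurable (streamCons (α := α)) := by
  refine measurable_pi_lambda _ fun j => ?_
  cases j with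
  | zero => exact measurable_fst
  | succ j => exact (measurable_pi_apply j).comp measurable_snd

lemma measurableSet_pi_range {t : ℕ → Set α} (ht : ∀ i, MeasurableSet (t i)) (n : ℕ) :
    MeasurableSet (Set.pi (Finset.range n) t) :=
  .pi (Finset.countable_toSet _) fun i _ => ht i

lemma eq_infinitePi_of_pi_range {η : ℕ → Measure α} [∀ i, IsProbabilityMeasure (η i)]
    {ν : Measure (ℕ → α)}
    (h : ∀ (n : ℕ) (t : ℕ → Set α), (∀ i, MeasurableSet (t i)) →
      ν (Set.pi (Finset.range n) t) = ∏ i ∈ Finset.range n, η i (t i)) :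
    ν = Measure.infinitePi η := by
  classical
  refine Measure.eq_infinitePi _ fun s t ht => ?_
  obtain ⟨n, hn⟩ := s.exists_nat_subset_range
  set t' : ℕ → Set α := fun i => if i ∈ s then t i else Set.univ with ht'
  have hpi : Set.pi (s : Set ℕ) t = Set.pi (Finset.range n) t' := by
    ext f
    simp only [Set.mem_pi, ht', Finset.mem_coe]
    refine ⟨fun hf i _ => ?_, fun hf i hi => by simpa [hi] using hf i (hn hi)⟩
    split_ifs with hi
    exacts [hf i hi, trivial]
  have ht'm : ∀ i, MeasurableSet (t' i) := fun i => by
    simp only [ht']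
    split_ifs
    exacts [ht i, .univ]
  rw [hpi, h n t' ht'm, ← Finset.prod_subset hn fun i _ hi => by simp [ht', hi]]
  exact Finset.prod_congr rfl fun i hi => by simp [ht', hi]

lemma map_streamCons (η : Measure α) [IsProbabilityMeasure η] :
    (η.prod (Measure.infinitePi fun _ : ℕ => η)).map streamCons =
      Measure.infinitePi fun _ : ℕ => η := by
  refine eq_infinitePi_of_pi_range fun n t ht => ?_
  rw [Measure.map_apply measurable_streamCons (measurableSet_pi_range ht n)]
  cases n with
  | zero => simp
  | succ n =>
    rw [streamCons_preimage_pi_range, Measure.prod_prod,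
      Measure.infinitePi_pi _ fun i _ => ht (i + 1), Finset.prod_range_succ', mul_comm]

lemma lintegral_infinitePi_streamCons (η : Measure α) [IsProbabilityMeasure η]
    {f : (ℕ → α) → ENNReal} (hf : Measurable f) :
    ∫⁻ e, f e ∂(Measure.infinitePi fun _ : ℕ => η) =
      ∫⁻ z, ∫⁻ e, f (streamCons (z, e)) ∂(Measure.infinitePi fun _ : ℕ => η) ∂η := by
  conv_lhs => rw [← map_streamCons η]
  rw [lintegral_map hf measurable_streamCons,
    lintegral_prod (fun p => f (streamCons p)) (hf.comp measurable_streamCons).aemeasurable]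

lemma map_iterate_eq_infinitePi {E : Type*} [MeasurableSpace E] {P : Measure E}
    [IsProbabilityMeasure P] {Q : Measure α} [IsProbabilityMeasure Q] {ξ : E → α} {θ : E → E}
    (hξ : Measurable ξ) (hθ : Measurable θ) (h : P.map (fun e => (ξ e, θ e)) = Q.prod P) :
    P.map (fun e i => ξ (θ^[i] e)) = Measure.infinitePi fun _ : ℕ => Q := by
  set obs : E → ℕ → α := fun e i => ξ (θ^[i] e)
  have hm : Measurable obs := measurable_pi_lambda _ fun i => hξ.comp (hθ.iterate i)
  have hcons : ∀ e, obs e = streamCons (ξ e, obs (θ e)) := fun e => by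
    ext i
    cases i <;> rfl
  refine eq_infinitePi_of_pi_range fun n t ht => ?_
  rw [Measure.map_apply hm (measurableSet_pi_range ht n)]
  induction n generalizing t with
  | zero => simp
  | succ n ih =>
    set B := Set.pi (Finset.range n) (fun j => t (j + 1))
    have hB : MeasurableSet (obs ⁻¹' B) := hm (measurableSet_pi_range (fun j => ht (j + 1)) n)
    have hpre : obs ⁻¹' Set.pi (Finset.range (n + 1)) t =
        (fun e => (ξ e, θ e)) ⁻¹' (t 0 ×ˢ (obs ⁻¹' B)) := by
      ext e
      rw [Set.mem_preimage, hcons, ← Set.mem_preimage, streamCons_preimage_pi_range]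
      rfl
    rw [hpre, ← Measure.map_apply (hξ.prodMk hθ) ((ht 0).prod hB), h, Measure.prod_prod,
      ih _ fun i => ht (i + 1), Finset.prod_range_succ', mul_comm]

end Sequences

/-! ### Superposition of Poisson streams -/

section Streams

variable {F : Type*}

/-- The marked arrival stream `f`, a sequence of pairs (time until the next arrival, mark) whose
first time is counted from the present, as it is seen `t` time units later. This is the remaining
stream if its first arrival is later than `t`. -/
def advance (t : ℝ) (f : ℕ → ℝ × F) : ℕ → ℝ × F :=
  streamCons (((f 0).1 - t, (f 0).2), fun j => f (j + 1))

variable [MeasurableSpace F]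

@[fun_prop]
lemma measurable_advance (t : ℝ) : Measurable (advance t : (ℕ → ℝ × F) → ℕ → ℝ × F) :=
  measurable_streamCons.comp (by fun_prop)

lemma measurable_uncurry_advance :
    Measurable (fun p : ℝ × (ℕ → ℝ × F) => advance p.1 p.2) :=
  measurable_streamCons.comp (by fun_prop)

/-- The law of a Poisson stream of rate `r` with independent marks of law `ν`. -/
noncomputable def streamLaw (r : ℝ) (ν : Measure F) : Measure (ℕ → ℝ × F) :=
  Measure.infinitePi fun _ => (expMeasure r).prod ν

instance (r : ℝ) [IsProbabilityMeasure (expMeasure r)] (ν : Measure F)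
    [IsProbabilityMeasure ν] : IsProbabilityMeasure (streamLaw r ν) := by
  unfold streamLaw
  infer_instance

section SingleStream

variable {r : ℝ} [IsProbabilityMeasure (expMeasure r)] (ν : Measure F) [IsProbabilityMeasure ν]

lemma lintegral_streamLaw {f : (ℕ → ℝ × F) → ENNReal} (hf : Measurable f) :
    ∫⁻ e, f e ∂streamLaw r ν =
      ∫⁻ x, ∫⁻ s, ∫⁻ e, f (streamCons ((x, s), e)) ∂streamLaw r ν ∂ν ∂expMeasure r := by
  have hm : Measurable (fun z : ℝ × F => ∫⁻ e, f (streamCons (z, e)) ∂streamLaw r ν) :=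
    (hf.comp measurable_streamCons).lintegral_prod_right'
  unfold streamLaw at *
  rw [lintegral_infinitePi_streamCons _ hf, lintegral_prod _ hm.aemeasurable]

lemma setLIntegral_streamLaw_advance {t : ℝ} (ht : 0 ≤ t) {f : (ℕ → ℝ × F) → ENNReal}
    (hf : Measurable f) :
    ∫⁻ e in {e | t < (e 0).1}, f (advance t e) ∂streamLaw r ν =
      ENNReal.ofReal (Real.exp (-(r * t))) * ∫⁻ e, f e ∂streamLaw r ν := by
  have hs : MeasurableSet {e : ℕ → ℝ × F | t < (e 0).1} :=
    measurableSet_lt measurable_const (by fun_prop)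
  have hm : Measurable (fun x : ℝ => ∫⁻ s, ∫⁻ e, f (streamCons ((x, s), e)) ∂streamLaw r ν ∂ν) :=
    (Measurable.lintegral_prod_right'
      (f := fun p : (ℝ × F) × (ℕ → ℝ × F) => f (streamCons p))
      (hf.comp measurable_streamCons)).lintegral_prod_right'
  have hfa : Measurable (fun e => f (advance t e)) := hf.comp (measurable_advance t)
  rw [← lintegral_indicator hs, lintegral_streamLaw ν (hfa.indicator hs),
    lintegral_streamLaw ν hf, ← setLIntegral_Ioi_expMeasure r ht hm,
    ← lintegral_indicator measurableSet_Ioi]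
  refine lintegral_congr fun x => ?_
  have hmem : ∀ s e, streamCons ((x, s), e) ∈ {e : ℕ → ℝ × F | t < (e 0).1} ↔ t < x :=
    fun s e => Iff.rfl
  by_cases hx : t < x
  · simp only [Set.indicator, hmem, Set.mem_Ioi, hx, if_true]
    rfl
  · simp only [Set.indicator, hmem, Set.mem_Ioi, hx, if_false, lintegral_zero]

lemma map_advance_streamLaw {t : ℝ} (ht : 0 ≤ t) :
    ((streamLaw r ν).restrict {e | t < (e 0).1}).map (advance t) =
      ENNReal.ofReal (Real.exp (-(r * t))) • streamLaw r ν := by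
  refine Measure.ext_of_lintegral _ fun f hf => ?_
  rw [lintegral_map hf (measurable_advance t), setLIntegral_streamLaw_advance ν ht hf,
    lintegral_smul_measure, smul_eq_mul]

end SingleStream

variable {N : ℕ} (lam : Fin N → ℝ) (ν : Fin N → Measure F)

/-- The law of independent Poisson streams, one for each class `n`, of rate `lam n` and with marks
of law `ν n`. -/
noncomputable def streamsLaw : Measure (Fin N → ℕ → ℝ × F) :=
  Measure.pi fun n => streamLaw (lam n) (ν n)

variable [∀ n, IsProbabilityMeasure (expMeasure (lam n))] [∀ n, IsProbabilityMeasure (ν n)]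

instance : IsProbabilityMeasure (streamsLaw lam ν) := by
  unfold streamsLaw
  infer_instance

lemma map_advance_streamsLaw {t : ℝ} (ht : 0 ≤ t) :
    ((streamsLaw lam ν).restrict {e | ∀ n, t < (e n 0).1}).map (fun e n => advance t (e n)) =
      ENNReal.ofReal (Real.exp (-((∑ n, lam n) * t))) • streamsLaw lam ν := by
  have hs : {e : Fin N → ℕ → ℝ × F | ∀ n, t < (e n 0).1} =
      Set.univ.pi fun _ => {e | t < (e 0).1} := by
    ext
    simp
  unfold streamsLaw
  rw [hs, Measure.restrict_pi_pi, Measure.pi_map_pi fun n => (measurable_advance t).aemeasurable]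
  refine Measure.pi_eq fun s _ => ?_
  simp_rw [map_advance_streamLaw (ν _) ht, Measure.smul_apply, Measure.pi_pi, smul_eq_mul]
  rw [Finset.prod_mul_distrib, ← ENNReal.ofReal_prod_of_nonneg fun _ _ => (Real.exp_pos _).le,
    ← Real.exp_sum, Finset.sum_neg_distrib, Finset.sum_mul]

end Streams

section Marks

variable {F : Type*} [MeasurableSpace F] {N : ℕ}

/-- The law of the class and the mark of a packet of the superposition of Poisson streams of rates
`lam n` with marks of laws `ν n`. -/
noncomputable def markLaw (lam : Fin N → ℝ) (ν : Fin N → Measure F) : Measure (Fin N × F) :=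
  ∑ n, ENNReal.ofReal (lam n / ∑ m, lam m) • (ν n).map (Prod.mk n)

variable {lam : Fin N → ℝ} (ν : Fin N → Measure F)

lemma lintegral_markLaw {f : Fin N × F → ENNReal} (hf : Measurable f) :
    ∫⁻ z, f z ∂markLaw lam ν =
      ∑ n, ENNReal.ofReal (lam n / ∑ m, lam m) * ∫⁻ s, f (n, s) ∂ν n := by
  rw [markLaw, lintegral_finsetSum_measure]
  refine Finset.sum_congr rfl fun n _ => ?_
  rw [lintegral_smul_measure, lintegral_map hf measurable_prodMk_left, smul_eq_mul]

lemma integrable_markLaw {f : Fin N × F → ℝ} (hf : Measurable f)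
    (h : ∀ n, Integrable (fun s => f (n, s)) (ν n)) : Integrable f (markLaw lam ν) :=
  integrable_finsetSum_measure.2 fun n _ => Integrable.smul_measure
    ((integrable_map_measure hf.aestronglyMeasurable (by fun_prop)).2 (h n)) ENNReal.ofReal_ne_top

variable (hlam : ∀ n, 0 < lam n)

include hlam

lemma integral_markLaw {f : Fin N × F → ℝ} (hf : Measurable f)
    (h : ∀ n, Integrable (fun s => f (n, s)) (ν n)) :
    ∫ z, f z ∂markLaw lam ν = (∑ n, lam n * ∫ s, f (n, s) ∂ν n) / ∑ m, lam m := by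
  rw [markLaw, integral_finsetSum_measure fun n _ => ((integrable_map_measure
      hf.aestronglyMeasurable (by fun_prop)).2 (h n)).smul_measure ENNReal.ofReal_ne_top,
    Finset.sum_div]
  refine Finset.sum_congr rfl fun n _ => ?_
  have hn : 0 ≤ lam n / ∑ m, lam m :=
    div_nonneg (hlam n).le (Finset.sum_nonneg fun m _ => (hlam m).le)
  rw [integral_smul_measure, integral_map (by fun_prop) hf.aestronglyMeasurable,
    ENNReal.toReal_ofReal hn, smul_eq_mul]
  ring

variable [NeZero N]

lemma sum_rate_pos : 0 < ∑ m, lam m :=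
  Finset.sum_pos (fun n _ => hlam n) Finset.univ_nonempty

lemma sum_ofReal_div_sum_eq_one : ∑ n, ENNReal.ofReal (lam n / ∑ m, lam m) = 1 := by
  have hsum := sum_rate_pos hlam
  rw [← ENNReal.ofReal_sum_of_nonneg fun n _ => (div_pos (hlam n) hsum).le, ← Finset.sum_div,
    div_self hsum.ne', ENNReal.ofReal_one]

lemma isProbabilityMeasure_markLaw [∀ n, IsProbabilityMeasure (ν n)] :
    IsProbabilityMeasure (markLaw lam ν) where
  measure_univ := by
    rw [← lintegral_one, lintegral_markLaw _ measurable_const]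
    simp [sum_ofReal_div_sum_eq_one hlam]

end Marks

section FirstArrival

variable {F : Type*} {N : ℕ}

/-- The streams that remain after the first arrival, if this is of class `n`. -/
def dropFirst (n : Fin N) (e : Fin N → ℕ → ℝ × F) : Fin N → ℕ → ℝ × F :=
  fun m => if m = n then fun j => e n (j + 1) else advance (e n 0).1 (e m)

/-- The first arrival is of class `n`. Ties are excluded; they have probability zero. -/
def FirstIs (n : Fin N) (e : Fin N → ℕ → ℝ × F) : Prop :=
  ∀ m, m ≠ n → (e n 0).1 < (e m 0).1

lemma FirstIs.unique {n m : Fin N} {e : Fin N → ℕ → ℝ × F} (hn : FirstIs n e)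
    (hm : FirstIs m e) : n = m := by
  by_contra h
  exact lt_asymm (hn m (Ne.symm h)) (hm n h)

lemma pairwise_disjoint_firstIs :
    Pairwise (Function.onFun Disjoint fun n : Fin N => {e : Fin N → ℕ → ℝ × F | FirstIs n e}) :=
  fun _ _ hnm => Set.disjoint_left.2 fun _ hn hm => hnm (hn.unique hm)

lemma firstIs_insertNth_iff {M : ℕ} (n : Fin (M + 1)) (f : ℕ → ℝ × F)
    (g : Fin M → ℕ → ℝ × F) :
    FirstIs n (n.insertNth f g : Fin (M + 1) → ℕ → ℝ × F) ↔ ∀ m, (f 0).1 < (g m 0).1 := by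
  refine ⟨fun h m => by simpa using h (n.succAbove m) (Fin.succAbove_ne n m), fun h m hm => ?_⟩
  obtain ⟨j, rfl⟩ := Fin.exists_succAbove_eq hm
  simpa using h j

lemma dropFirst_insertNth {M : ℕ} (n : Fin (M + 1)) (f : ℕ → ℝ × F)
    (g : Fin M → ℕ → ℝ × F) :
    dropFirst n (n.insertNth f g : Fin (M + 1) → ℕ → ℝ × F) =
      n.insertNth (fun j => f (j + 1)) (fun m => advance (f 0).1 (g m)) := by
  funext m
  rcases Fin.eq_self_or_eq_succAbove n m with rfl | ⟨j, rfl⟩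
  · simp [dropFirst]
  · simp [dropFirst, Fin.succAbove_ne]

open Classical in
/-- The class of the first packet; a junk value if several first packets arrive at once. -/
noncomputable def firstClass [NeZero N] (e : Fin N → ℕ → ℝ × F) : Fin N :=
  if h : ∃ n, FirstIs n e then h.choose else 0

lemma FirstIs.firstClass_eq [NeZero N] {n : Fin N} {e : Fin N → ℕ → ℝ × F} (h : FirstIs n e) :
    firstClass e = n := by
  have hex : ∃ n, FirstIs n e := ⟨n, h⟩
  rw [firstClass, dif_pos hex]
  exact hex.choose_spec.unique h

/-- What is observed at the first arrival: its time, and the class and the mark of the packet. -/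
noncomputable def firstPacket [NeZero N] (e : Fin N → ℕ → ℝ × F) : ℝ × (Fin N × F) :=
  ((e (firstClass e) 0).1, firstClass e, (e (firstClass e) 0).2)

/-- The streams that remain after the first arrival. -/
noncomputable def nextStreams [NeZero N] (e : Fin N → ℕ → ℝ × F) : Fin N → ℕ → ℝ × F :=
  dropFirst (firstClass e) e

variable [MeasurableSpace F]

@[fun_prop]
lemma measurable_dropFirst (n : Fin N) :
    Measurable (dropFirst n : (Fin N → ℕ → ℝ × F) → Fin N → ℕ → ℝ × F) := by
  refine measurable_pi_lambda _ fun m => ?_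
  unfold dropFirst
  split_ifs
  · fun_prop
  · exact measurable_uncurry_advance.comp (by fun_prop : Measurable fun e : Fin N → ℕ → ℝ × F =>
      ((e n 0).1, e m))

lemma measurableSet_firstIs (n : Fin N) :
    MeasurableSet {e : Fin N → ℕ → ℝ × F | FirstIs n e} := by
  simp only [FirstIs, Set.ofPred_forall]
  exact .iInter fun m => .iInter fun _ => measurableSet_lt (by fun_prop) (by fun_prop)

lemma measurable_firstClass [NeZero N] :
    Measurable (firstClass : (Fin N → ℕ → ℝ × F) → Fin N) := by
  refine measurable_to_countable' fun n => ?_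
  have hpre : firstClass ⁻¹' {n} = {e : Fin N → ℕ → ℝ × F | FirstIs n e} ∪
      ((⋃ m, {e | FirstIs m e})ᶜ ∩ {_e | (0 : Fin N) = n}) := by
    ext e
    simp only [Set.mem_preimage, Set.mem_singleton_iff, Set.mem_union, Set.mem_ofPred_eq,
      Set.mem_inter_iff, Set.mem_compl_iff, Set.mem_iUnion]
    by_cases h : ∃ m, FirstIs m e
    · obtain ⟨m, hm⟩ := h
      rw [hm.firstClass_eq]
      exact ⟨fun hmn => Or.inl (hmn ▸ hm), fun hn => hn.elim hm.unique
        fun hno => absurd ⟨m, hm⟩ hno.1⟩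
    · rw [firstClass, dif_neg h]
      exact ⟨fun h0 => Or.inr ⟨h, h0⟩, fun hn => hn.elim (fun hn => absurd ⟨n, hn⟩ h) And.right⟩
  rw [hpre]
  exact (measurableSet_firstIs n).union
    ((MeasurableSet.iUnion measurableSet_firstIs).compl.inter (MeasurableSet.const _))

lemma measurable_firstPacket [NeZero N] :
    Measurable (firstPacket : (Fin N → ℕ → ℝ × F) → ℝ × (Fin N × F)) := by
  have h : Measurable (fun p : Fin N × (Fin N → ℕ → ℝ × F) =>
      ((p.2 p.1 0).1, p.1, (p.2 p.1 0).2)) :=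
    measurable_from_prod_countable_right fun n => by fun_prop
  exact h.comp (measurable_firstClass.prodMk measurable_id)

lemma measurable_nextStreams [NeZero N] :
    Measurable (nextStreams : (Fin N → ℕ → ℝ × F) → Fin N → ℕ → ℝ × F) := by
  have h : Measurable (fun p : Fin N × (Fin N → ℕ → ℝ × F) => dropFirst p.1 p.2) :=
    measurable_from_prod_countable_right fun n => measurable_dropFirst n
  exact h.comp (measurable_firstClass.prodMk measurable_id)

section Split

variable {M : ℕ} (n : Fin (M + 1))

@[fun_prop]
lemma measurable_insertNth : Measurable (fun p : (ℕ → ℝ × F) × (Fin M → ℕ → ℝ × F) =>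
    (n.insertNth p.1 p.2 : Fin (M + 1) → ℕ → ℝ × F)) :=
  (MeasurableEquiv.piFinSuccAbove (fun _ : Fin (M + 1) => ℕ → ℝ × F) n).symm.measurable

variable (lam : Fin (M + 1) → ℝ) [∀ n, IsProbabilityMeasure (expMeasure (lam n))]
  (ν : Fin (M + 1) → Measure F) [∀ n, IsProbabilityMeasure (ν n)]

lemma lintegral_streamsLaw_insertNth {G : (Fin (M + 1) → ℕ → ℝ × F) → ENNReal}
    (hG : Measurable G) :
    ∫⁻ e, G e ∂streamsLaw lam ν =
      ∫⁻ f, ∫⁻ g, G (n.insertNth f g) ∂streamsLaw (fun j => lam (n.succAbove j))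
        (fun j => ν (n.succAbove j)) ∂streamLaw (lam n) (ν n) := by
  have hmp := (measurePreserving_piFinSuccAbove (fun n => streamLaw (lam n) (ν n)) n).symm
  rw [streamsLaw, ← hmp.map_eq, lintegral_map hG hmp.measurable,
    lintegral_prod (fun p => G _) (hG.comp hmp.measurable).aemeasurable]
  rfl

/-- Each of the other streams contributes a factor `exp (-(lam j * t))` at `t = (f 0).1`, and by
memorylessness `dropFirst` leaves their law unchanged. -/
lemma lintegral_indicator_firstIs_insertNth {Φ : (ℝ × F) × (Fin (M + 1) → ℕ → ℝ × F) → ENNReal}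
    (hΦ : Measurable Φ) {f : ℕ → ℝ × F} (hf : 0 ≤ (f 0).1) :
    ∫⁻ g, {e | FirstIs n e}.indicator (fun e => Φ (e n 0, dropFirst n e)) (n.insertNth f g)
        ∂streamsLaw (fun j => lam (n.succAbove j)) (fun j => ν (n.succAbove j)) =
      ENNReal.ofReal (Real.exp (-((∑ j, lam (n.succAbove j)) * (f 0).1))) *
        ∫⁻ g, Φ (f 0, n.insertNth (fun j => f (j + 1)) g)
          ∂streamsLaw (fun j => lam (n.succAbove j)) (fun j => ν (n.succAbove j)) := by
  have hadv : Measurable (fun (e : Fin M → ℕ → ℝ × F) m => advance (f 0).1 (e m)) := by fun_prop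
  have hlater : MeasurableSet {g : Fin M → ℕ → ℝ × F | ∀ m, (f 0).1 < (g m 0).1} := by
    simp only [Set.ofPred_forall]
    exact .iInter fun m => measurableSet_lt (by fun_prop) (by fun_prop)
  have hΨ : Measurable (fun g : Fin M → ℕ → ℝ × F =>
      Φ (f 0, n.insertNth (fun j => f (j + 1)) g)) :=
    hΦ.comp (measurable_const.prodMk ((measurable_insertNth n).comp measurable_prodMk_left))
  rw [← smul_eq_mul, ← lintegral_smul_measure, ← map_advance_streamsLaw _ _ hf,
    lintegral_map hΨ hadv, ← lintegral_indicator hlater]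
  refine lintegral_congr fun g => ?_
  simp only [Set.indicator, Set.mem_ofPred_eq, firstIs_insertNth_iff, dropFirst_insertNth,
    Fin.insertNth_apply_same]

end Split

variable (lam : Fin N → ℝ) [∀ n, IsProbabilityMeasure (expMeasure (lam n))]
  (ν : Fin N → Measure F) [∀ n, IsProbabilityMeasure (ν n)]
  [IsProbabilityMeasure (expMeasure (∑ m, lam m))]

lemma setLIntegral_firstIs (hlam : ∀ n, 0 < lam n) (n : Fin N)
    {Φ : (ℝ × F) × (Fin N → ℕ → ℝ × F) → ENNReal} (hΦ : Measurable Φ) :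
    ∫⁻ e in {e | FirstIs n e}, Φ (e n 0, dropFirst n e) ∂streamsLaw lam ν =
      ENNReal.ofReal (lam n / ∑ m, lam m) *
        ∫⁻ p, Φ p ∂((expMeasure (∑ m, lam m)).prod (ν n)).prod (streamsLaw lam ν) := by
  obtain ⟨M, rfl⟩ : ∃ M, N = M + 1 := Nat.exists_eq_succ_of_ne_zero n.pos.ne'
  have hothers : 0 ≤ ∑ j, lam (n.succAbove j) := Finset.sum_nonneg fun j _ => (hlam _).le
  have hstep : Measurable ({e | FirstIs n e}.indicator fun e => Φ (e n 0, dropFirst n e)) :=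
    (hΦ.comp (by fun_prop)).indicator (measurableSet_firstIs n)
  have hstepSplit : Measurable (fun p : (ℕ → ℝ × F) × (Fin M → ℕ → ℝ × F) =>
      {e | FirstIs n e}.indicator (fun e => Φ (e n 0, dropFirst n e)) (n.insertNth p.1 p.2)) :=
    hstep.comp (measurable_insertNth n)
  have hmark : Measurable (fun z => ∫⁻ e, Φ (z, e) ∂streamsLaw lam ν) := hΦ.lintegral_prod_right'
  rw [lintegral_prod _ hΦ.aemeasurable, lintegral_prod _ hmark.aemeasurable,
    Fin.sum_univ_succAbove lam n,
    ← lintegral_exp_neg_mul_expMeasure (hlam n) hothers hmark.lintegral_prod_right',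
    ← lintegral_indicator (measurableSet_firstIs n),
    lintegral_streamsLaw_insertNth n lam ν hstep,
    lintegral_streamLaw _ hstepSplit.lintegral_prod_right']
  refine lintegral_congr_ae ?_
  filter_upwards [ae_pos_expMeasure (lam n)] with x hx
  rw [← lintegral_const_mul' _ _ ENNReal.ofReal_ne_top]
  refine lintegral_congr fun s => ?_
  rw [lintegral_streamsLaw_insertNth n lam ν (G := fun e => Φ ((x, s), e))
      (hΦ.comp measurable_prodMk_left),
    ← lintegral_const_mul' _ _ ENNReal.ofReal_ne_top]
  exact lintegral_congr fun e =>
    lintegral_indicator_firstIs_insertNth n lam ν hΦ (f := streamCons ((x, s), e)) hx.le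

variable [NeZero N]

lemma iUnion_firstIs_ae_eq_univ (hlam : ∀ n, 0 < lam n) :
    (⋃ n, {e : Fin N → ℕ → ℝ × F | FirstIs n e}) =ᵐ[streamsLaw lam ν] Set.univ := by
  rw [eventuallyEq_univ, mem_ae_iff_prob_eq_one (MeasurableSet.iUnion measurableSet_firstIs),
    measure_iUnion pairwise_disjoint_firstIs measurableSet_firstIs, tsum_fintype,
    ← sum_ofReal_div_sum_eq_one hlam]
  refine Finset.sum_congr rfl fun n _ => ?_
  simpa using setLIntegral_firstIs lam ν hlam n (Φ := fun _ => 1) measurable_const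

lemma map_firstPacket_nextStreams (hlam : ∀ n, 0 < lam n) :
    (streamsLaw lam ν).map (fun e => (firstPacket e, nextStreams e)) =
      ((expMeasure (∑ m, lam m)).prod (markLaw lam ν)).prod (streamsLaw lam ν) := by
  have := isProbabilityMeasure_markLaw ν hlam
  refine Measure.ext_of_lintegral _ fun f hf => ?_
  have hrest : Measurable (fun z => ∫⁻ e, f (z, e) ∂streamsLaw lam ν) := hf.lintegral_prod_right'
  rw [lintegral_map hf (measurable_firstPacket.prodMk measurable_nextStreams),
    lintegral_prod _ hf.aemeasurable, lintegral_prod_symm _ hrest.aemeasurable,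
    lintegral_markLaw ν hrest.lintegral_prod_left', ← setLIntegral_univ,
    ← setLIntegral_congr (iUnion_firstIs_ae_eq_univ lam ν hlam),
    lintegral_iUnion measurableSet_firstIs pairwise_disjoint_firstIs, tsum_fintype]
  refine Finset.sum_congr rfl fun n _ => ?_
  have hlabel : Measurable (fun p : (ℝ × F) × (Fin N → ℕ → ℝ × F) =>
      f ((p.1.1, n, p.1.2), p.2)) :=
    hf.comp (by fun_prop)
  calc ∫⁻ e in {e | FirstIs n e}, f (firstPacket e, nextStreams e) ∂streamsLaw lam ν
      = ∫⁻ e in {e | FirstIs n e}, f (((e n 0).1, n, (e n 0).2), dropFirst n e)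
          ∂streamsLaw lam ν :=
        setLIntegral_congr_fun (measurableSet_firstIs n) fun e (he : FirstIs n e) => by
          simp only [firstPacket, nextStreams, he.firstClass_eq]
    _ = _ := by
        rw [setLIntegral_firstIs lam ν hlam n hlabel, lintegral_prod _ hlabel.aemeasurable,
          lintegral_prod_symm _ hlabel.lintegral_prod_right'.aemeasurable]

end FirstArrival

/-! ### Sample paths of the queue -/

section Path

variable {N : ℕ} [NeZero N]

lemma earliest_le (f : Fin N → ℝ) (m : Fin N) : f (earliest f) ≤ f m :=
  Classical.choose_spec (Finite.exists_min f) m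

lemma earliest_eq {f : Fin N → ℝ} {n : Fin N} (h : ∀ m, m ≠ n → f n < f m) : earliest f = n := by
  by_contra hne
  exact (earliest_le f n).not_gt (h _ hne)

variable (I X : Fin N → ℕ → ℝ)

/-- The generation time of the packet before the `i`-th one, or `0` if there is none. -/
noncomputable def prevGenerationTime : ℕ → ℝ
  | 0 => 0
  | i + 1 => generationTime I i

/-- The time between the arrivals of the `(i - 1)`-st and the `i`-th packet, in order of arrival,
the first one being counted from time `0`. -/
noncomputable def interTime (i : ℕ) : ℝ :=
  generationTime I i - prevGenerationTime I i

lemma arrivalTime_succ {N : ℕ} (I : Fin N → ℕ → ℝ) (n : Fin N) (k : ℕ) :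
    arrivalTime I n (k + 1) = arrivalTime I n k + I n (k + 1) :=
  Finset.sum_range_succ _ _

lemma arrivedBefore_succ_self (i : ℕ) :
    arrivedBefore I (i + 1) (packetClass I i) = arrivedBefore I i (packetClass I i) + 1 :=
  Function.update_self ..

lemma arrivedBefore_succ_of_ne {i : ℕ} {m : Fin N} (h : m ≠ packetClass I i) :
    arrivedBefore I (i + 1) m = arrivedBefore I i m :=
  Function.update_of_ne h ..

lemma arrivedBefore_eq_count (n : Fin N) (i : ℕ) :
    arrivedBefore I i n = Nat.count (fun j => packetClass I j = n) i := by
  induction i with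
  | zero => simp [arrivedBefore]
  | succ i ih =>
    rw [Nat.count_succ, ← ih]
    split_ifs with h
    · rw [← h, arrivedBefore_succ_self]
    · rw [arrivedBefore_succ_of_ne I (Ne.symm h), add_zero]

/-- The streams of pairs (time until the arrival, service time) of the packets that are not among
the first `i` ones, as seen from the arrival of the last of these `i` packets. -/
noncomputable def streamsFrom (i : ℕ) (m : Fin N) : ℕ → ℝ × ℝ
  | 0 => (arrivalTime I m (arrivedBefore I i m) - prevGenerationTime I i,
      X m (arrivedBefore I i m))
  | j + 1 => (I m (arrivedBefore I i m + (j + 1)), X m (arrivedBefore I i m + (j + 1)))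

lemma streamsFrom_zero : streamsFrom I X 0 = fun m j => (I m j, X m j) := by
  ext m (_ | j) <;> simp [streamsFrom, arrivedBefore, arrivalTime, prevGenerationTime]

variable {I X}

lemma firstClass_streamsFrom {i : ℕ} (h : ∃ n, FirstIs n (streamsFrom I X i)) :
    firstClass (streamsFrom I X i) = packetClass I i := by
  obtain ⟨n, hn⟩ := h
  rw [hn.firstClass_eq]
  exact (earliest_eq fun m hm => sub_lt_sub_iff_right _ |>.1 (hn m hm)).symm

lemma nextStreams_streamsFrom {i : ℕ} (h : ∃ n, FirstIs n (streamsFrom I X i)) :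
    nextStreams (streamsFrom I X i) = streamsFrom I X (i + 1) := by
  rw [nextStreams, firstClass_streamsFrom h]
  ext1 m
  by_cases hm : m = packetClass I i
  · subst hm
    ext1 (_ | j)
    · simp [dropFirst, streamsFrom, arrivedBefore_succ_self, arrivalTime_succ,
        prevGenerationTime, generationTime]
    · simp [dropFirst, streamsFrom, arrivedBefore_succ_self, add_assoc, add_comm 1]
  · ext1 (_ | j)
    · simp [dropFirst, hm, advance, streamCons, streamsFrom, arrivedBefore_succ_of_ne,
        prevGenerationTime, generationTime]
    · simp [dropFirst, hm, advance, streamCons, streamsFrom, arrivedBefore_succ_of_ne]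

lemma iterate_nextStreams
    (h : ∀ i, ∃ n, FirstIs n (nextStreams^[i] fun m j => (I m j, X m j))) (i : ℕ) :
    nextStreams^[i] (fun m j => (I m j, X m j)) = streamsFrom I X i := by
  induction i with
  | zero => exact (streamsFrom_zero I X).symm
  | succ i ih =>
    rw [Function.iterate_succ_apply', ih, nextStreams_streamsFrom (ih ▸ h i)]

lemma firstPacket_iterate_nextStreams
    (h : ∀ i, ∃ n, FirstIs n (nextStreams^[i] fun m j => (I m j, X m j))) (i : ℕ) :
    firstPacket (nextStreams^[i] fun m j => (I m j, X m j)) =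
      (interTime I i, packetClass I i, serviceTime I X i) := by
  have hi := h i
  rw [iterate_nextStreams h] at hi ⊢
  rw [firstPacket, firstClass_streamsFrom hi]
  rfl

lemma waitingTime_eq_lindley (I X : Fin N → ℕ → ℝ) :
    waitingTime I X = lindley (serviceTime I X) (interTime I) := by
  ext i
  induction i with
  | zero => simp [waitingTime, serviceStart, lindley]
  | succ i ih =>
    rw [lindley, ← ih, waitingTime, serviceStart, waitingTime, interTime, prevGenerationTime,
      max_comm, ← max_sub_sub_right]
    congr 1 <;> ring

lemma receptionTime_strictMono (hX : ∀ n k, 0 < X n k) : StrictMono (receptionTime I X) :=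
  strictMono_nat_of_lt_succ fun i =>
    calc receptionTime I X i ≤ serviceStart I X (i + 1) := le_max_right _ _
      _ < receptionTime I X (i + 1) := lt_add_of_pos_right _ (hX _ _)

variable {n : Fin N}

lemma generationTime_of_packetClass_eq {i : ℕ} (h : packetClass I i = n) :
    generationTime I i = arrivalTime I n (Nat.count (fun j => packetClass I j = n) i) := by
  rw [generationTime, h, arrivedBefore_eq_count]

variable (hinf : {i | packetClass I i = n}.Infinite)

include hinf

lemma generationTime_nth (k : ℕ) :
    generationTime I (Nat.nth (fun i => packetClass I i = n) k) = arrivalTime I n k := by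
  rw [generationTime_of_packetClass_eq (Nat.nth_mem_of_infinite hinf k),
    Nat.count_nth_of_infinite hinf]

lemma serviceTime_nth (k : ℕ) :
    serviceTime I X (Nat.nth (fun i => packetClass I i = n) k) = X n k := by
  have hclass : packetClass I (Nat.nth (fun i => packetClass I i = n) k) = n :=
    Nat.nth_mem_of_infinite hinf k
  rw [serviceTime, hclass, arrivedBefore_eq_count, Nat.count_nth_of_infinite hinf]

lemma dropTime_strictMono (hX : ∀ n k, 0 < X n k) : StrictMono (dropTime I X n) :=
  (receptionTime_strictMono hX).comp (Nat.nth_strictMono hinf)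

lemma age_eq_of_lt_dropTime (hI : ∀ k, 0 ≤ I n k) (hX : ∀ n k, 0 < X n k) {k : ℕ} {t : ℝ}
    (hlo : ∀ l < k, dropTime I X n l ≤ t) (hhi : t < dropTime I X n k) :
    age I X n t = t - ∑ j ∈ Finset.range k, I n j := by
  have hmono : Monotone (fun l => ∑ j ∈ Finset.range l, I n j) :=
    monotone_nat_of_le_succ fun l => by
      rw [Finset.sum_range_succ]
      exact le_add_of_nonneg_right (hI l)
  refine congrArg (t - ·) (IsGreatest.csSup_eq ⟨?_, ?_⟩)
  · cases k with
    | zero => exact Or.inl rfl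
    | succ k => exact Or.inr ⟨_, Nat.nth_mem_of_infinite hinf k, hlo k k.lt_succ_self,
        (generationTime_nth hinf k).symm⟩
  · rintro g (rfl | ⟨i, hi, hit, rfl⟩)
    · exact Finset.sum_nonneg fun j _ => hI j
    · have hik : i < Nat.nth (fun i => packetClass I i = n) k :=
        (receptionTime_strictMono hX).lt_iff_lt.1 (hit.trans_lt hhi)
      rw [← Nat.nth_count (p := fun i => packetClass I i = n) hi, Nat.nth_lt_nth hinf] at hik
      rw [generationTime_of_packetClass_eq hi]
      exact hmono hik

lemma peakAge_eq_dropTime_sub (hI : ∀ k, 0 ≤ I n k) (hX : ∀ n k, 0 < X n k) (k : ℕ) :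
    peakAge I X n k = dropTime I X n k - ∑ j ∈ Finset.range k, I n j := by
  have hdrop := dropTime_strictMono hinf hX
  obtain ⟨lo, hlo, hlo'⟩ : ∃ lo < dropTime I X n k, ∀ l < k, dropTime I X n l ≤ lo := by
    cases k with
    | zero => exact ⟨dropTime I X n 0 - 1, sub_one_lt _, fun l hl => absurd hl l.not_lt_zero⟩
    | succ k => exact ⟨dropTime I X n k, hdrop k.lt_succ_self,
        fun l hl => hdrop.monotone (Nat.le_of_lt_succ hl)⟩
  have hage : ∀ᶠ t in 𝓝[<] dropTime I X n k, t - ∑ j ∈ Finset.range k, I n j = age I X n t := by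
    filter_upwards [Ioo_mem_nhdsLT hlo] with t ht
    exact (age_eq_of_lt_dropTime hinf hI hX (fun l hl => (hlo' l hl).trans ht.1.le) ht.2).symm
  exact leftLim_eq_of_tendsto (Tendsto.congr' hage
    (((continuous_id.sub continuous_const).tendsto _).mono_left nhdsWithin_le_nhds))

lemma peakAge_eq (hI : ∀ k, 0 ≤ I n k) (hX : ∀ n k, 0 < X n k) (k : ℕ) :
    peakAge I X n k =
      I n k + X n k + waitingTime I X (Nat.nth (fun i => packetClass I i = n) k) := by
  rw [peakAge_eq_dropTime_sub hinf hI hX, dropTime, receptionTime, waitingTime,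
    serviceTime_nth hinf, generationTime_nth hinf, arrivalTime, Finset.sum_range_succ]
  ring

end Path

/-! ### The queue with a marked Poisson input -/

section Marked

variable {Ω : Type*} [mΩ : MeasurableSpace Ω] {μ : Measure Ω} {F G : Type*} [MeasurableSpace F]
  [MeasurableSpace G]

lemma ae_hasAverage_comp {Q : Measure F} {ξ : ℕ → Ω → F} (hξ : ∀ i, Measurable (ξ i))
    (hind : iIndepFun ξ μ) (hlaw : ∀ i, μ.map (ξ i) = Q) {f : F → ℝ} (hf : Measurable f)
    (hint : Integrable f Q) : ∀ᵐ ω ∂μ, HasAverage (fun i => f (ξ i ω)) (∫ z, f z ∂Q) := by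
  have hmean : ∫ ω, f (ξ 0 ω) ∂μ = ∫ z, f z ∂Q := by
    rw [← hlaw 0, integral_map (hξ 0).aemeasurable hf.aestronglyMeasurable]
  rw [← hmean]
  exact strong_law_ae_real (fun i ω => f (ξ i ω))
    (((hlaw 0).symm ▸ hint).comp_measurable (hξ 0))
    (fun i j hij => (hind.indepFun hij).comp hf hf)
    (fun i => IdentDistrib.comp ⟨(hξ i).aemeasurable, (hξ 0).aemeasurable,
      (hlaw i).trans (hlaw 0).symm⟩ hf)

/-- The filtration generated by a sequence of measurable functions. It differs from
`Filtration.natural` in that the codomain needs no topology. -/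
def historyFiltration {ξ : ℕ → Ω → F} (hξ : ∀ i, Measurable (ξ i)) : Filtration ℕ mΩ where
  seq i := ⨆ j ≤ i, MeasurableSpace.comap (ξ j) inferInstance
  mono' _ _ hij := biSup_mono fun _ => ge_trans hij
  le' _ := iSup₂_le fun j _ => (hξ j).comap_le

lemma measurable_historyFiltration {ξ : ℕ → Ω → F} (hξ : ∀ i, Measurable (ξ i)) (i : ℕ) :
    Measurable[historyFiltration hξ i] (ξ i) :=
  Measurable.of_comap_le (le_iSup₂ (f := fun j (_ : j ≤ i) =>
    MeasurableSpace.comap (ξ j) inferInstance) i le_rfl)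

lemma indep_historyFiltration {ξ : ℕ → Ω → F} (hξ : ∀ i, Measurable (ξ i)) (hind : iIndepFun ξ μ)
    (i : ℕ) :
    Indep (historyFiltration hξ i) (MeasurableSpace.comap (ξ (i + 1)) inferInstance) μ := by
  suffices Indep (⨆ k ∈ {k | k ≤ i}, MeasurableSpace.comap (ξ k) inferInstance)
      (⨆ k ∈ ({i + 1} : Set ℕ), MeasurableSpace.comap (ξ k) inferInstance) μ by
    rwa [iSup_singleton] at this
  exact indep_iSup_of_disjoint (fun k => (hξ k).comap_le) hind (by simp)

lemma measurable_lindley {𝒢 : Filtration ℕ mΩ} {S T : ℕ → Ω → ℝ} (hS : ∀ i, Measurable[𝒢 i] (S i))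
    (hT : ∀ i, Measurable[𝒢 i] (T i)) (i : ℕ) :
    Measurable[𝒢 i] fun ω => lindley (S · ω) (T · ω) i := by
  induction i with
  | zero => exact measurable_const
  | succ i ih =>
    have hi : Measurable[𝒢 (i + 1)] fun ω => lindley (S · ω) (T · ω) i + S i ω :=
      (ih.add (hS i)).mono (𝒢.mono i.le_succ) le_rfl
    exact (hi.sub (hT (i + 1))).max measurable_const

/-- `ξ` is a Poisson stream of rate `r` with independent marks of law `κ`: `(ξ i).1` is the time
between the points `i - 1` and `i` of the stream, and `(ξ i).2` is the mark of point `i`. -/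
structure IsMarkedPoisson (μ : Measure Ω) (r : ℝ) (κ : Measure G) (ξ : ℕ → Ω → ℝ × G) : Prop where
  measurable : ∀ i, Measurable (ξ i)
  indep : iIndepFun ξ μ
  law : ∀ i, μ.map (ξ i) = (expMeasure r).prod κ

lemma lintegral_sq_le_of_le_mul {Q : Measure F} {h ψ : F → ℝ} {v : ℝ} (hv : 0 ≤ v)
    (hh : Integrable h Q) (hh0 : ∀ z, 0 ≤ h z) (hψ : ∀ᵐ z ∂Q, ψ z ^ 2 ≤ v ^ 2 * h z) :
    ∫⁻ z, ENNReal.ofReal (ψ z ^ 2) ∂Q ≤ ENNReal.ofReal ((∫ z, h z ∂Q) * (1 + v) ^ 2) := by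
  rw [← integral_mul_const, ofReal_integral_eq_lintegral_ofReal (hh.mul_const _)
    (ae_of_all _ fun z => mul_nonneg (hh0 z) (sq_nonneg _))]
  refine lintegral_mono_ae (hψ.mono fun z hz => ENNReal.ofReal_le_ofReal (hz.trans ?_))
  rw [mul_comm]
  have := hh0 z
  gcongr
  linarith

lemma sq_workload_increment_le {r u x : ℝ} (hr : 0 ≤ r) (hx : 0 ≤ x) (hu : 0 ≤ u) :
    (max (u - x) 0 - r / 2 * (u ^ 2 - max (u - x) 0 ^ 2)) ^ 2 ≤ u ^ 2 * (1 + r * x) ^ 2 := by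
  set m := max (u - x) 0
  have hm0 : 0 ≤ m := le_max_right _ _
  have hmu : m ≤ u := max_le (by linarith) hu
  have hmx : u - x ≤ m := le_max_left _ _
  have hdiff : u ^ 2 - m ^ 2 ≤ 2 * u * x := by nlinarith
  have hdiff0 : 0 ≤ u ^ 2 - m ^ 2 := by nlinarith
  have hrdiff : r * (u ^ 2 - m ^ 2) ≤ r * (2 * u * x) := mul_le_mul_of_nonneg_left hdiff hr
  have hrdiff0 : 0 ≤ r * (u ^ 2 - m ^ 2) := mul_nonneg hr hdiff0
  have : 0 ≤ u * (r * x) := mul_nonneg hu (mul_nonneg hr hx)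
  rw [← mul_pow]
  refine sq_le_sq' ?_ ?_ <;> linarith

namespace IsMarkedPoisson

variable {r : ℝ} {κ : Measure G} {ξ : ℕ → Ω → ℝ × G}

lemma ae_interarrival_pos (h : IsMarkedPoisson μ r κ ξ) : ∀ᵐ ω ∂μ, ∀ i, 0 < (ξ i ω).1 := by
  refine ae_all_iff.2 fun i =>
    ae_of_ae_map (p := fun z => 0 < z.1) (h.measurable i).aemeasurable ?_
  rw [h.law i]
  exact Measure.quasiMeasurePreserving_fst.ae (ae_pos_expMeasure r)

variable [IsProbabilityMeasure κ]

lemma ae_hasAverage_interarrival (h : IsMarkedPoisson μ r κ ξ) (hr : 0 < r) :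
    ∀ᵐ ω ∂μ, HasAverage (fun i => (ξ (i + 1) ω).1) (1 / r) := by
  have := isProbabilityMeasure_expMeasure hr
  have hint : Integrable (fun x : ℝ => x) (expMeasure r) := by
    simpa only [pow_one] using integrable_pow_expMeasure hr 1
  have havg := ae_hasAverage_comp (fun i => h.measurable (i + 1))
    (h.indep.precomp (add_left_injective 1)) (fun i => h.law (i + 1)) measurable_fst
    (hint.comp_fst κ)
  simpa [integral_fun_fst (fun x : ℝ => x), integral_id_expMeasure hr] using havg

lemma ae_hasAverage_mark (h : IsMarkedPoisson μ r κ ξ) (hr : 0 < r) {f : G → ℝ} (hf : Measurable f)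
    (hint : Integrable f κ) : ∀ᵐ ω ∂μ, HasAverage (fun i => f (ξ i ω).2) (∫ g, f g ∂κ) := by
  have := isProbabilityMeasure_expMeasure hr
  have havg := ae_hasAverage_comp h.measurable h.indep h.law (hf.comp measurable_snd)
    (hint.comp_snd (expMeasure r))
  simpa [integral_fun_snd f] using havg

variable {sv : G → ℝ}

lemma ae_exists_sum_sq_div_normalizer_sojourn_le (h : IsMarkedPoisson μ r κ ξ) (hr : 0 < r)
    (hsv : Measurable sv) (hsv0 : ∀ᵐ ω ∂μ, ∀ i, 0 ≤ sv (ξ i ω).2) (hsv2 : MemLp sv 2 κ) :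
    ∀ᵐ ω ∂μ, ∃ c, ∀ n, ∑ i ∈ Finset.range n,
      ((1 + sojourn (fun j => sv (ξ j ω).2) (fun j => (ξ j ω).1) i) /
        normalizer (sojourn (fun j => sv (ξ j ω).2) fun j => (ξ j ω).1) i) ^ 2 ≤ c := by
  filter_upwards [h.ae_interarrival_pos, hsv0,
    h.ae_hasAverage_mark hr (hsv.pow_const 2) hsv2.integrable_sq] with ω hT hS hS2
  exact exists_sum_sq_div_normalizer_sojourn_le hS (fun i => (hT i).le) hS2

/-- The increments `ψ (sojourn i, ξ (i + 1))` are martingale differences. The law of large numbers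
for them is applied to the absolute values of the sojourn times, since these are nonnegative only
almost surely. -/
lemma ae_sum_isLittleO_normalizer_sojourn [IsProbabilityMeasure μ] (h : IsMarkedPoisson μ r κ ξ)
    (hr : 0 < r) (hsv : Measurable sv) (hsv0 : ∀ᵐ ω ∂μ, ∀ i, 0 ≤ sv (ξ i ω).2)
    (hsv2 : MemLp sv 2 κ) {ψ : ℝ × ℝ × G → ℝ} (hψ : Measurable ψ)
    (h0 : ∀ v, 0 ≤ v → ∫ z, ψ (v, z) ∂(expMeasure r).prod κ = 0) {C : ℝ} (hC : 0 ≤ C)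
    (h2 : ∀ v, 0 ≤ v → ∫⁻ z, ENNReal.ofReal (ψ (v, z) ^ 2) ∂(expMeasure r).prod κ ≤
      ENNReal.ofReal (C * (1 + v) ^ 2)) :
    ∀ᵐ ω ∂μ, (fun n : ℕ => ∑ i ∈ Finset.range n,
        ψ (sojourn (fun j => sv (ξ j ω).2) (fun j => (ξ j ω).1) i, ξ (i + 1) ω)) =o[atTop]
      normalizer (sojourn (fun j => sv (ξ j ω).2) fun j => (ξ j ω).1) := by
  have := isProbabilityMeasure_expMeasure hr
  let V : ℕ → Ω → ℝ := fun i ω => |sojourn (fun j => sv (ξ j ω).2) (fun j => (ξ j ω).1) i|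
  have hV : ∀ᵐ ω ∂μ, (V · ω) = sojourn (fun j => sv (ξ j ω).2) fun j => (ξ j ω).1 :=
    hsv0.mono fun ω hω => funext fun i => abs_of_nonneg (sojourn_nonneg hω i)
  let 𝒢 := historyFiltration h.measurable
  have hξ : ∀ i, Measurable[𝒢 i] (ξ i) := measurable_historyFiltration h.measurable
  have hS : ∀ i, Measurable[𝒢 i] fun ω => sv (ξ i ω).2 := fun i => hsv.comp (hξ i).snd
  have hVm : ∀ i, Measurable[𝒢 i] (V i) := fun i =>
    continuous_abs.measurable.comp ((measurable_lindley hS (fun j => (hξ j).fst) i).add (hS i))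
  have hlim := ae_sum_isLittleO_normalizer (𝒢 := 𝒢) (fun i => hξ (i + 1))
    (indep_historyFiltration h.measurable h.indep) (fun i => h.law (i + 1)) hVm
    (fun _ _ => abs_nonneg _) hψ h0 hC h2 (by
      filter_upwards [hV, h.ae_exists_sum_sq_div_normalizer_sojourn_le hr hsv hsv0 hsv2]
        with ω hω hsum
      simpa only [funext_iff.1 hω, hω] using hsum)
  filter_upwards [hV, hlim] with ω hω hlim
  simpa only [funext_iff.1 hω, hω] using hlim

lemma ae_workloadNoise_isLittleO [IsProbabilityMeasure μ] (h : IsMarkedPoisson μ r κ ξ)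
    (hr : 0 < r) (hsv : Measurable sv) (hsv0 : ∀ᵐ ω ∂μ, ∀ i, 0 ≤ sv (ξ i ω).2)
    (hsv2 : MemLp sv 2 κ) :
    ∀ᵐ ω ∂μ, workloadNoise r (fun j => sv (ξ j ω).2) (fun j => (ξ j ω).1) =o[atTop]
      normalizer (sojourn (fun j => sv (ξ j ω).2) fun j => (ξ j ω).1) := by
  have := isProbabilityMeasure_expMeasure hr
  refine h.ae_sum_isLittleO_normalizer_sojourn hr hsv hsv0 hsv2
    (ψ := fun p => max (p.1 - p.2.1) 0 - r / 2 * (p.1 ^ 2 - max (p.1 - p.2.1) 0 ^ 2))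
    (by fun_prop) (fun v hv => ?_)
    (C := ∫ z, (1 + r * z.1) ^ 2 ∂(expMeasure r).prod κ) (integral_nonneg fun z => sq_nonneg _)
    fun v hv => lintegral_sq_le_of_le_mul hv ?_ (fun z => sq_nonneg _) ?_
  · simp [integral_fun_fst fun x => max (v - x) 0 - r / 2 * (v ^ 2 - max (v - x) 0 ^ 2),
      integral_max_sub_expMeasure hr hv]
  · have hexpand : ∀ x : ℝ, (1 + r * x) ^ 2 = 1 + 2 * r * x ^ 1 + r ^ 2 * x ^ 2 := fun x => by ring
    have hint : Integrable (fun x : ℝ => (1 + r * x) ^ 2) (expMeasure r) := by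
      simp_rw [hexpand]
      exact ((integrable_const 1).add ((integrable_pow_expMeasure hr 1).const_mul _)).add
        ((integrable_pow_expMeasure hr 2).const_mul _)
    exact hint.comp_fst κ
  · filter_upwards [Measure.quasiMeasurePreserving_fst.ae (ae_pos_expMeasure r)] with z hz
    exact sq_workload_increment_le hr.le hz.le hv

lemma ae_markNoise_isLittleO [IsProbabilityMeasure μ] (h : IsMarkedPoisson μ r κ ξ)
    (hr : 0 < r) (hsv : Measurable sv) (hsv0 : ∀ᵐ ω ∂μ, ∀ i, 0 ≤ sv (ξ i ω).2)
    (hsv2 : MemLp sv 2 κ) {f : G → ℝ} (hf : Measurable f) (hf2 : MemLp f 2 κ) :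
    ∀ᵐ ω ∂μ, markNoise (fun j => f (ξ j ω).2) (∫ g, f g ∂κ) (fun j => sv (ξ j ω).2)
        (fun j => (ξ j ω).1) =o[atTop]
      normalizer (sojourn (fun j => sv (ξ j ω).2) fun j => (ξ j ω).1) := by
  have := isProbabilityMeasure_expMeasure hr
  have hcentered : MemLp (fun g => f g - ∫ g, f g ∂κ) 2 κ := hf2.sub (memLp_const _)
  refine h.ae_sum_isLittleO_normalizer_sojourn hr hsv hsv0 hsv2
    (ψ := fun p => max (p.1 - p.2.1) 0 * (f p.2.2 - ∫ g, f g ∂κ)) (by fun_prop) (fun v _ => ?_)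
    (C := ∫ z, (f z.2 - ∫ g, f g ∂κ) ^ 2 ∂(expMeasure r).prod κ)
    (integral_nonneg fun z => sq_nonneg _)
    fun v hv => lintegral_sq_le_of_le_mul hv (hcentered.integrable_sq.comp_snd _)
      (fun z => sq_nonneg _) ?_
  · rw [integral_prod_mul (fun x => max (v - x) 0) fun g => f g - ∫ g, f g ∂κ,
      integral_sub (hf2.integrable one_le_two) (integrable_const _)]
    simp
  · filter_upwards [Measure.quasiMeasurePreserving_fst.ae (ae_pos_expMeasure r)] with z hz
    rw [mul_pow]
    gcongr
    exact max_le (by linarith) hv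

lemma ae_hasAverage_lindley_mul [IsProbabilityMeasure μ] (h : IsMarkedPoisson μ r κ ξ)
    (hr : 0 < r) (hsv : Measurable sv) (hsv0 : ∀ᵐ ω ∂μ, ∀ i, 0 ≤ sv (ξ i ω).2)
    (hsv2 : MemLp sv 2 κ) (hρ : r * ∫ g, sv g ∂κ < 1) {f : G → ℝ} (hf : Measurable f)
    (hf2 : MemLp f 2 κ) :
    ∀ᵐ ω ∂μ, HasAverage
      (fun i => lindley (fun j => sv (ξ j ω).2) (fun j => (ξ j ω).1) i * f (ξ i ω).2)
      ((∫ g, f g ∂κ) * (r * (∫ g, sv g ^ 2 ∂κ) / (2 * (1 - r * ∫ g, sv g ∂κ)))) := by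
  filter_upwards [hsv0, h.ae_hasAverage_interarrival hr,
    h.ae_hasAverage_mark hr hsv (hsv2.integrable one_le_two),
    h.ae_hasAverage_mark hr (hsv.pow_const 2) hsv2.integrable_sq,
    h.ae_workloadNoise_isLittleO hr hsv hsv0 hsv2,
    h.ae_markNoise_isLittleO hr hsv hsv0 hsv2 hsv hsv2,
    h.ae_markNoise_isLittleO hr hsv hsv0 hsv2 hf hf2] with ω hS hT hS1 hS2 hM hMS hMf
  exact hasAverage_lindley_mul (hasAverage_lindley hr hρ hS hS1 hS2 hT hM hMS)
    (normalizer_sojourn_isBigO hr.le hρ hS hS1 hS2 hM hMS) hMf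

end IsMarkedPoisson

end Marked

/-! ### Averages over the packets of one class -/

section ClassAverage

variable {p : ℕ → Prop} [DecidablePred p]

lemma sum_range_count_nth {M : Type*} [AddCommMonoid M] (f : ℕ → M) (m : ℕ) :
    ∑ k ∈ Finset.range (Nat.count p m), f (Nat.nth p k) =
      ∑ i ∈ Finset.range m, if p i then f i else 0 := by
  induction m with
  | zero => simp
  | succ m ih =>
    rw [Finset.sum_range_succ, ← ih, Nat.count_succ]
    split_ifs with h
    · rw [Finset.sum_range_succ, Nat.nth_count h]
    · simp

lemma infinite_setOf_of_hasAverage {a : ℝ} (ha : 0 < a)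
    (h : HasAverage (fun i => if p i then 1 else 0) a) : {i | p i}.Infinite := by
  intro hfin
  have hle : ∀ n : ℕ, (∑ i ∈ Finset.range n, if p i then (1 : ℝ) else 0) ≤
      hfin.toFinset.card := by
    intro n
    rw [Finset.sum_boole]
    refine Nat.cast_le.2 (Finset.card_le_card fun i hi => ?_)
    exact hfin.mem_toFinset.2 (Finset.mem_filter.1 hi).2
  have hzero : Tendsto (fun n : ℕ => (hfin.toFinset.card : ℝ) / n) atTop (𝓝 0) :=
    tendsto_const_div_atTop_nhds_zero_nat _
  exact ha.not_ge (le_of_tendsto_of_tendsto' h hzero fun n => by gcongr; exact hle n)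

lemma hasAverage_comp_nth {a w : ℝ} (ha : 0 < a) {f : ℕ → ℝ}
    (h : HasAverage (fun i => if p i then 1 else 0) a)
    (hf : HasAverage (fun i => if p i then f i else 0) (a * w)) :
    HasAverage (fun k => f (Nat.nth p k)) w := by
  have hinf := infinite_setOf_of_hasAverage ha h
  have htop : Tendsto (Nat.nth p) atTop atTop := (Nat.nth_strictMono hinf).tendsto_atTop
  have hquot := (hf.comp htop).div (h.comp htop) ha.ne'
  rw [mul_div_cancel_left₀ _ ha.ne'] at hquot
  refine hquot.congr' ?_
  filter_upwards [htop.eventually_ge_atTop 1] with K hK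
  have hm : ((Nat.nth p K : ℕ) : ℝ) ≠ 0 := by positivity
  have hcount : Nat.count p (Nat.nth p K) = K := Nat.count_nth_of_infinite hinf K
  simp only [Pi.div_apply, Function.comp_apply]
  rw [← sum_range_count_nth f, ← sum_range_count_nth fun _ => (1 : ℝ), hcount,
    div_div_div_cancel_right₀ hm]
  simp

lemma hasAverage_peakAge {N : ℕ} [NeZero N] {I X : Fin N → ℕ → ℝ} {n : Fin N} {q a b w : ℝ}
    (hI : ∀ k, 0 ≤ I n k) (hX : ∀ n k, 0 < X n k) (hq : 0 < q) (hIavg : HasAverage (I n) a)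
    (hXavg : HasAverage (X n) b)
    (hclass : HasAverage (fun i => if packetClass I i = n then 1 else 0) q)
    (hW : HasAverage (fun i => if packetClass I i = n then waitingTime I X i else 0) (q * w)) :
    HasAverage (peakAge I X n) (a + b + w) := by
  have hinf := infinite_setOf_of_hasAverage hq hclass
  refine ((hIavg.add hXavg).add (hasAverage_comp_nth hq hclass hW)).congr fun K => ?_
  simp_rw [peakAge_eq hinf hI hX, Finset.sum_add_distrib]
  ring

end ClassAverage

/-! ### The packets of the multi-class queue -/

section Model

variable {Ω : Type*} [MeasurableSpace Ω] {μ : Measure Ω}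

lemma map_prodMk_eq_infinitePi_prod {ι E : Type*} [MeasurableSpace E] {f g : ι → Ω → E}
    {ν ρ : ι → Measure E} [∀ i, IsProbabilityMeasure (ν i)] [∀ i, IsProbabilityMeasure (ρ i)]
    (hf : ∀ i, Measurable (f i)) (hg : ∀ i, Measurable (g i)) (hν : ∀ i, μ.map (f i) = ν i)
    (hρ : ∀ i, μ.map (g i) = ρ i) (hind : iIndepFun (Sum.elim f g) μ) :
    μ.map (fun ω i => (f i ω, g i ω)) = Measure.infinitePi fun i => (ν i).prod (ρ i) := by
  let Z : ι × Bool → Ω → E := fun p => bif p.2 then g p.1 else f p.1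
  let L : ι → Bool → Measure E := fun i b => bif b then ρ i else ν i
  have hL : ∀ i b, IsProbabilityMeasure (L i b) := by
    rintro i (_ | _) <;> simp only [L, cond_true, cond_false] <;> infer_instance
  have hZlaw : ∀ p : ι × Bool, HasLaw (Z p) (L p.1 p.2) μ := by
    rintro ⟨i, _ | _⟩
    exacts [⟨(hf i).aemeasurable, hν i⟩, ⟨(hg i).aemeasurable, hρ i⟩]
  have hZm : Measurable fun ω p => Z p ω := by
    refine measurable_pi_iff.2 ?_
    rintro ⟨i, _ | _⟩
    exacts [hf i, hg i]
  have hZind : iIndepFun Z μ := by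
    convert hind.precomp (g := fun p : ι × Bool => bif p.2 then Sum.inr p.1 else Sum.inl p.1)
      (by rintro ⟨i, _ | _⟩ ⟨j, _ | _⟩ h <;> simp_all) using 1
    funext ⟨i, b⟩
    cases b <;> rfl
  let pair : (Bool → E) → E × E := fun z => (z false, z true)
  have hpair : Measurable pair := by fun_prop
  have hpairs : Measurable fun (z : ι → Bool → E) i => pair (z i) :=
    measurable_pi_lambda _ fun i => hpair.comp (measurable_pi_apply i)
  have hcurry : Measurable (MeasurableEquiv.curry ι Bool E) := MeasurableEquiv.measurable _
  calc μ.map (fun ω i => (f i ω, g i ω))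
      = ((μ.map fun ω p => Z p ω).map (MeasurableEquiv.curry ι Bool E)).map
          fun z i => pair (z i) := by
        rw [Measure.map_map hcurry hZm, Measure.map_map hpairs (hcurry.comp hZm)]
        rfl
    _ = Measure.infinitePi fun i => (Measure.infinitePi (L i)).map pair := by
        rw [(hZind.hasLaw_infinitePi hZlaw hZm.aemeasurable).map_eq,
          Measure.infinitePi_map_curry, Measure.infinitePi_map_pi _ fun _ => hpair]
    _ = Measure.infinitePi fun i => (ν i).prod (ρ i) := by
        congr! 2 with i
        exact Measure.infinitePi_map_eval_prod (P := L i) Bool.false_ne_true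

variable {N : ℕ} {lam x y : Fin N → ℝ} {I X : Fin N → ℕ → Ω → ℝ}

namespace IsMultiClassMG1

lemma isProbabilityMeasure_serviceLaw [IsProbabilityMeasure μ]
    (hq : IsMultiClassMG1 μ lam x y I X) (n : Fin N) : IsProbabilityMeasure (μ.map (X n 0)) :=
  Measure.isProbabilityMeasure_map (hq.measurable_service n 0).aemeasurable

lemma measurable_streams (hq : IsMultiClassMG1 μ lam x y I X) :
    Measurable fun ω n k => (I n k ω, X n k ω) :=
  measurable_pi_lambda _ fun n => measurable_pi_lambda _ fun k =>
    (hq.measurable_interarrival n k).prodMk (hq.measurable_service n k)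

lemma map_streams (hq : IsMultiClassMG1 μ lam x y I X)
    [∀ n, IsProbabilityMeasure (expMeasure (lam n))] [∀ n, IsProbabilityMeasure (μ.map (X n 0))] :
    μ.map (fun ω n j => (I n j ω, X n j ω)) = streamsLaw lam fun n => μ.map (X n 0) := by
  have hpairs := map_prodMk_eq_infinitePi_prod
    (fun q : Fin N × ℕ => hq.measurable_interarrival q.1 q.2)
    (fun q => hq.measurable_service q.1 q.2) (fun q => (hq.interarrival_law q.1 q.2).map_eq)
    (fun q => (hq.service_identDistrib q.1 q.2).map_eq) hq.indep
  have hcurry := congrArg (Measure.map (MeasurableEquiv.curry (Fin N) ℕ (ℝ × ℝ))) hpairs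
  rw [Measure.infinitePi_map_curry (fun (n : Fin N) (_ : ℕ) =>
      (expMeasure (lam n)).prod (μ.map (X n 0))),
    Measure.map_map (MeasurableEquiv.measurable _) (measurable_pi_lambda _ fun q : Fin N × ℕ =>
      (hq.measurable_interarrival q.1 q.2).prodMk (hq.measurable_service q.1 q.2)),
    Measure.infinitePi_eq_pi] at hcurry
  exact hcurry

lemma ae_interarrival_pos (hq : IsMultiClassMG1 μ lam x y I X) :
    ∀ᵐ ω ∂μ, ∀ n k, 0 < I n k ω :=
  ae_all_iff.2 fun n => ae_all_iff.2 fun k =>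
    ae_of_ae_map (hq.measurable_interarrival n k).aemeasurable
      ((hq.interarrival_law n k).map_eq ▸ ae_pos_expMeasure _)

lemma ae_service_pos (hq : IsMultiClassMG1 μ lam x y I X) : ∀ᵐ ω ∂μ, ∀ n k, 0 < X n k ω :=
  ae_all_iff.2 fun n => ae_all_iff.2 fun k => hq.service_pos n k

lemma ae_hasAverage_interarrival (hq : IsMultiClassMG1 μ lam x y I X) (n : Fin N) :
    ∀ᵐ ω ∂μ, HasAverage (fun k => I n k ω) (1 / lam n) := by
  have hind : iIndepFun (I n) μ := hq.indep.precomp (g := fun k : ℕ => Sum.inl (n, k))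
    fun k l h => by simpa using h
  rw [← integral_id_expMeasure (hq.rate_pos n)]
  exact ae_hasAverage_comp (hq.measurable_interarrival n) hind
    (fun k => (hq.interarrival_law n k).map_eq) measurable_id
    (by simpa only [pow_one] using integrable_pow_expMeasure (hq.rate_pos n) 1)

lemma ae_hasAverage_service [IsProbabilityMeasure μ] (hq : IsMultiClassMG1 μ lam x y I X)
    (n : Fin N) : ∀ᵐ ω ∂μ, HasAverage (fun k => X n k ω) (x n) := by
  have hind : iIndepFun (X n) μ := hq.indep.precomp (g := fun k : ℕ => Sum.inr (n, k))
    fun k l h => by simpa using h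
  rw [← hq.service_mean n]
  exact strong_law_ae_real (X n) ((hq.service_memLp n).integrable one_le_two)
    (fun i j hij => hind.indepFun hij) (hq.service_identDistrib n)

lemma memLp_serviceTime_markLaw (hq : IsMultiClassMG1 μ lam x y I X) :
    MemLp (fun z : Fin N × ℝ => z.2) 2 (markLaw lam fun n => μ.map (X n 0)) :=
  (memLp_two_iff_integrable_sq (by fun_prop)).2 <|
    integrable_markLaw _ (by fun_prop) fun n =>
      (integrable_map_measure (by fun_prop) (hq.measurable_service n 0).aemeasurable).2
        (hq.service_memLp n).integrable_sq

lemma memLp_class_markLaw [IsProbabilityMeasure μ]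
    (hq : IsMultiClassMG1 μ lam x y I X) (φ : Fin N → ℝ) :
    MemLp (fun z : Fin N × ℝ => φ z.1) 2 (markLaw lam fun n => μ.map (X n 0)) := by
  have := hq.isProbabilityMeasure_serviceLaw
  have hφ : Measurable fun z : Fin N × ℝ => φ z.1 := (measurable_of_countable φ).comp measurable_fst
  exact (memLp_two_iff_integrable_sq hφ.aestronglyMeasurable).2
    (integrable_markLaw _ (hφ.pow_const 2) fun n => integrable_const (φ n ^ 2))

lemma integral_serviceTime_markLaw [IsProbabilityMeasure μ]
    (hq : IsMultiClassMG1 μ lam x y I X) :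
    ∫ z, z.2 ∂markLaw lam (fun n => μ.map (X n 0)) = (∑ n, lam n * x n) / ∑ n, lam n := by
  have hX : ∀ n, AEMeasurable (X n 0) μ := fun n => (hq.measurable_service n 0).aemeasurable
  rw [integral_markLaw _ hq.rate_pos measurable_snd fun n =>
    (integrable_map_measure (by fun_prop) (hX n)).2 ((hq.service_memLp n).integrable one_le_two)]
  simp_rw [fun n => integral_map (f := fun s : ℝ => s) (hX n) (by fun_prop), hq.service_mean]

lemma integral_sq_serviceTime_markLaw (hq : IsMultiClassMG1 μ lam x y I X) :
    ∫ z, z.2 ^ 2 ∂markLaw lam (fun n => μ.map (X n 0)) = (∑ n, lam n * y n) / ∑ n, lam n := by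
  have hX : ∀ n, AEMeasurable (X n 0) μ := fun n => (hq.measurable_service n 0).aemeasurable
  rw [integral_markLaw (f := fun z => z.2 ^ 2) _ hq.rate_pos (by fun_prop) fun n =>
    (integrable_map_measure (by fun_prop) (hX n)).2 (hq.service_memLp n).integrable_sq]
  simp_rw [fun n => integral_map (f := fun s : ℝ => s ^ 2) (hX n) (by fun_prop),
    hq.service_secondMoment]

lemma integral_class_markLaw [IsProbabilityMeasure μ]
    (hq : IsMultiClassMG1 μ lam x y I X) (φ : Fin N → ℝ) :
    ∫ z, φ z.1 ∂markLaw lam (fun n => μ.map (X n 0)) = (∑ n, lam n * φ n) / ∑ n, lam n := by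
  have := hq.isProbabilityMeasure_serviceLaw
  rw [integral_markLaw (f := fun z => φ z.1) _ hq.rate_pos
    ((measurable_of_countable φ).comp measurable_fst) fun n => integrable_const (φ n)]
  simp

end IsMultiClassMG1

end Model

section Packets

variable {N : ℕ} [NeZero N] {Ω : Type*} [MeasurableSpace Ω] {μ : Measure Ω}
  {lam x y : Fin N → ℝ} {I X : Fin N → ℕ → Ω → ℝ}

/-- The time between the arrivals of the packets `i - 1` and `i` in the order of arrival, and the
class and the service time of packet `i`, obtained by repeatedly removing the first packet of the
superposed streams. It differs from `interTime`, `packetClass` and `serviceTime` at the paths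
where two classes have simultaneous arrivals. -/
noncomputable def packet (I X : Fin N → ℕ → Ω → ℝ) (i : ℕ) (ω : Ω) : ℝ × (Fin N × ℝ) :=
  firstPacket (nextStreams^[i] fun n k => (I n k ω, X n k ω))

namespace IsMultiClassMG1

variable [IsProbabilityMeasure μ]

lemma isMarkedPoisson_packet (hq : IsMultiClassMG1 μ lam x y I X) :
    IsMarkedPoisson μ (∑ n, lam n) (markLaw lam fun n => μ.map (X n 0)) (packet I X) := by
  have := fun n => isProbabilityMeasure_expMeasure (hq.rate_pos n)
  have := isProbabilityMeasure_expMeasure (sum_rate_pos hq.rate_pos)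
  have := hq.isProbabilityMeasure_serviceLaw
  have := isProbabilityMeasure_markLaw (fun n => μ.map (X n 0)) hq.rate_pos
  have hobs : ∀ i, Measurable fun e : Fin N → ℕ → ℝ × ℝ => firstPacket (nextStreams^[i] e) :=
    fun i => measurable_firstPacket.comp (measurable_nextStreams.iterate i)
  have hmeas : ∀ i, Measurable (packet I X i) := fun i => (hobs i).comp hq.measurable_streams
  have hjoint : μ.map (fun ω i => packet I X i ω) = Measure.infinitePi fun _ =>
      (expMeasure (∑ n, lam n)).prod (markLaw lam fun n => μ.map (X n 0)) := by
    rw [← map_iterate_eq_infinitePi measurable_firstPacket measurable_nextStreams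
        (map_firstPacket_nextStreams lam (fun n => μ.map (X n 0)) hq.rate_pos),
      ← hq.map_streams, Measure.map_map (measurable_pi_lambda _ hobs) hq.measurable_streams]
    rfl
  have hlaw : ∀ i, μ.map (packet I X i) =
      (expMeasure (∑ n, lam n)).prod (markLaw lam fun n => μ.map (X n 0)) := fun i => by
    rw [← Measure.infinitePi_map_eval (fun _ : ℕ => (expMeasure _).prod (markLaw lam _)) i,
      ← hjoint, Measure.map_map (measurable_pi_apply i) (measurable_pi_lambda _ hmeas)]
    rfl
  refine ⟨hmeas, ?_, hlaw⟩
  rw [iIndepFun_iff_map_fun_eq_infinitePi_map hmeas, hjoint]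
  simp_rw [hlaw]

lemma ae_packet_eq (hq : IsMultiClassMG1 μ lam x y I X) :
    ∀ᵐ ω ∂μ, ∀ i, packet I X i ω =
      (interTime (I · · ω) i, packetClass (I · · ω) i, serviceTime (I · · ω) (X · · ω) i) := by
  have := fun n => isProbabilityMeasure_expMeasure (hq.rate_pos n)
  have := isProbabilityMeasure_expMeasure (sum_rate_pos hq.rate_pos)
  have := hq.isProbabilityMeasure_serviceLaw
  have := isProbabilityMeasure_markLaw (fun n => μ.map (X n 0)) hq.rate_pos
  set P := streamsLaw lam fun n => μ.map (X n 0)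
  have hnext : MeasurePreserving nextStreams P P := by
    refine ⟨measurable_nextStreams, ?_⟩
    have hsnd := congrArg Measure.snd
      (map_firstPacket_nextStreams lam (fun n => μ.map (X n 0)) hq.rate_pos)
    rwa [Measure.snd_map_prodMk measurable_firstPacket, Measure.snd_prod] at hsnd
  have hfirst : ∀ᵐ e ∂P, ∃ n, FirstIs n e := by
    filter_upwards [eventuallyEq_univ.1 (iUnion_firstIs_ae_eq_univ lam _ hq.rate_pos)] with e he
    exact Set.mem_iUnion.1 he
  have hfirsts : ∀ᵐ ω ∂μ, ∀ i, ∃ n, FirstIs n (nextStreams^[i] fun n k => (I n k ω, X n k ω)) := by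
    refine ae_all_iff.2 fun i => ae_of_ae_map hq.measurable_streams.aemeasurable
      (p := fun e => ∃ n, FirstIs n (nextStreams^[i] e)) ?_
    rw [hq.map_streams]
    exact (hnext.iterate i).quasiMeasurePreserving.ae hfirst
  filter_upwards [hfirsts] with ω hω i
  exact firstPacket_iterate_nextStreams hω i

lemma ae_serviceTime_packet_nonneg (hq : IsMultiClassMG1 μ lam x y I X) :
    ∀ᵐ ω ∂μ, ∀ i, 0 ≤ (packet I X i ω).2.2 := by
  filter_upwards [hq.ae_packet_eq, hq.ae_service_pos] with ω hω hpos i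
  rw [hω i]
  exact (hpos _ _).le

lemma ae_hasAverage_packetClass (hq : IsMultiClassMG1 μ lam x y I X) (φ : Fin N → ℝ) :
    ∀ᵐ ω ∂μ, HasAverage (fun i => φ (packetClass (I · · ω) i))
      ((∑ n, lam n * φ n) / ∑ n, lam n) := by
  have := hq.isProbabilityMeasure_serviceLaw
  have := isProbabilityMeasure_markLaw (fun n => μ.map (X n 0)) hq.rate_pos
  filter_upwards [hq.ae_packet_eq, hq.isMarkedPoisson_packet.ae_hasAverage_mark
    (sum_rate_pos hq.rate_pos) ((measurable_of_countable φ).comp measurable_fst)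
    ((hq.memLp_class_markLaw φ).integrable one_le_two)] with ω hω havg
  simpa only [hω, hq.integral_class_markLaw, Function.comp_apply] using havg

lemma ae_hasAverage_waitingTime_mul (hq : IsMultiClassMG1 μ lam x y I X)
    (hrho : ∑ j, lam j * x j < 1) (φ : Fin N → ℝ) :
    ∀ᵐ ω ∂μ, HasAverage
      (fun i => waitingTime (I · · ω) (X · · ω) i * φ (packetClass (I · · ω) i))
      ((∑ n, lam n * φ n) / (∑ n, lam n) *
        ((∑ j, lam j * y j) / (2 * (1 - ∑ j, lam j * x j)))) := by
  have := hq.isProbabilityMeasure_serviceLaw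
  have := isProbabilityMeasure_markLaw (fun n => μ.map (X n 0)) hq.rate_pos
  have hsum := sum_rate_pos hq.rate_pos
  have hload : (∑ n, lam n) * ∫ z, z.2 ∂markLaw lam (fun n => μ.map (X n 0)) =
      ∑ j, lam j * x j := by
    rw [hq.integral_serviceTime_markLaw, mul_div_cancel₀ _ hsum.ne']
  have hPK := hq.isMarkedPoisson_packet.ae_hasAverage_lindley_mul hsum measurable_snd
    hq.ae_serviceTime_packet_nonneg hq.memLp_serviceTime_markLaw (hload ▸ hrho)
    ((measurable_of_countable φ).comp measurable_fst) (hq.memLp_class_markLaw φ)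
  simp only [Function.comp_apply, hq.integral_class_markLaw, hload,
    hq.integral_sq_serviceTime_markLaw, mul_div_cancel₀ _ hsum.ne'] at hPK
  filter_upwards [hq.ae_packet_eq, hPK] with ω hω hPK
  simpa only [hω, waitingTime_eq_lindley] using hPK

lemma isMeanWaitingTime (hq : IsMultiClassMG1 μ lam x y I X) (hrho : ∑ j, lam j * x j < 1) :
    IsMeanWaitingTime μ I X ((∑ j, lam j * y j) / (2 * (1 - ∑ j, lam j * x j))) := by
  filter_upwards [hq.ae_hasAverage_waitingTime_mul hrho fun _ => 1] with ω hω
  simp only [mul_one, div_self (sum_rate_pos hq.rate_pos).ne', one_mul] at hω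
  exact hω.congr fun K => by rw [div_eq_inv_mul, one_div]

lemma isPeakAoI (hq : IsMultiClassMG1 μ lam x y I X) (hrho : ∑ j, lam j * x j < 1) (n : Fin N) :
    IsPeakAoI μ I X n
      (1 / lam n + x n + (∑ j, lam j * y j) / (2 * (1 - ∑ j, lam j * x j))) := by
  have hclass := hq.ae_hasAverage_packetClass fun m => if m = n then (1 : ℝ) else 0
  have hW := hq.ae_hasAverage_waitingTime_mul hrho fun m => if m = n then (1 : ℝ) else 0
  simp only [mul_ite, mul_one, mul_zero, Finset.sum_ite_eq', Finset.mem_univ, if_true]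
    at hclass hW
  filter_upwards [hq.ae_interarrival_pos, hq.ae_service_pos, hq.ae_hasAverage_interarrival n,
    hq.ae_hasAverage_service n, hclass, hW] with ω hI hX hIavg hXavg hclass hW
  have hpeak := hasAverage_peakAge (I := (I · · ω)) (X := (X · · ω)) (fun k => (hI n k).le) hX
    (div_pos (hq.rate_pos n) (sum_rate_pos hq.rate_pos)) hIavg hXavg hclass hW
  exact hpeak.congr fun K => by rw [div_eq_inv_mul, one_div]

end IsMultiClassMG1

lemma IsPeakAoI.unique [NeZero μ] {n : Fin N} {a b : ℝ} (ha : IsPeakAoI μ I X n a)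
    (hb : IsPeakAoI μ I X n b) : a = b := by
  obtain ⟨ω, hωa, hωb⟩ := (ha.and hb).exists
  exact tendsto_nhds_unique hωa hωb

lemma IsMeanWaitingTime.unique [NeZero μ] {a b : ℝ} (ha : IsMeanWaitingTime μ I X a)
    (hb : IsMeanWaitingTime μ I X b) : a = b := by
  obtain ⟨ω, hωa, hωb⟩ := (ha.and hb).exists
  exact tendsto_nhds_unique hωa hωb

end Packets

end MG1

theorem mainTheorem1 {N : ℕ} [NeZero N] {Ω : Type*} [MeasurableSpace Ω]
    (μ : Measure Ω) [IsProbabilityMeasure μ]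
    (lam x y : Fin N → ℝ) (I X : Fin N → ℕ → Ω → ℝ)
    (hq : MG1.IsMultiClassMG1 μ lam x y I X)
    (hrho : ∑ j, lam j * x j < 1) :
    -- the peak age-of-information of every class
    (∀ n, MG1.IsPeakAoI μ I X n
      (1 / lam n + x n + (∑ j, lam j * y j) / (2 * (1 - ∑ j, lam j * x j)))) ∧
    -- the mean waiting time
    MG1.IsMeanWaitingTime μ I X ((∑ j, lam j * y j) / (2 * (1 - ∑ j, lam j * x j))) ∧
    -- conservation law and relation between the classes
    (∀ (A : Fin N → ℝ) (W : ℝ), (∀ n, MG1.IsPeakAoI μ I X n (A n)) →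
      MG1.IsMeanWaitingTime μ I X W →
        ∑ n, lam n * A n = (N : ℝ) + ∑ j, lam j * x j + (∑ j, lam j) * W ∧
        (∀ n m, A n - 1 / lam n - x n = A m - 1 / lam m - x m) ∧
        (∀ n m, 1 / lam n - 1 / lam m = (A n - x n) - (A m - x m)) ∧
        (∀ n m, lam n < lam m → A m - x m < A n - x n)) := by
  have hA := hq.isPeakAoI hrho
  have hW := hq.isMeanWaitingTime hrho
  refine ⟨hA, hW, fun A W hA' hW' => ?_⟩
  have eW := hW'.unique hW
  have eA : ∀ n, A n = 1 / lam n + x n + W := fun n => by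
    rw [eW]; exact (hA' n).unique (hA n)
  refine ⟨?_, fun n m => ?_, fun n m => ?_, fun n m hnm => ?_⟩
  · have e : ∀ n, lam n * A n = 1 + lam n * x n + lam n * W := fun n => by
      have := (hq.rate_pos n).ne'
      rw [eA]; field_simp
    simp_rw [e, Finset.sum_add_distrib, Finset.sum_mul]
    simp
  · rw [eA, eA]; ring
  · rw [eA, eA]; ring
  · rw [eA, eA]
    have := one_div_lt_one_div_of_lt (hq.rate_pos n) hnm
    linarith
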